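/- Conventions. A Polish group is a topological group whose topology is separable and completely metrizable. It is TSI if its topology is induced by a metric $d$ that is two-sided invariant, i.e. $d(gh,gk)=d(h,k)=d(hg,kg)$ for all $g,h,k$. It is non-archimedean if the identity has a neighborhood basis consisting of open subgroups. It is strongly NSS if there is an open set $V\ni 1$ such that for every sequence $(g_n)_{n\in\mathbb N}$ in the group which does not converge to $1$ there are $n_0<\dots<n_k$ with $g_{n_0}g_{n_1}\cdots g_{n_k}\notin V$. For a Polish group $G$, $G_0$ denotes the connected component of $1_G$, and $E(G)$ is the equivalence relation on $G^{\mathbb N}$ given by $$x\,E(G)\,y\iff \bigl(x(n)y(n)^{-1}\bigr)_n\text{ converges in }G .$$ For equivalence relations $E,F$ on Polish spaces $X,Y$, $E\le_B F$ means that there is a Borel map $f:X\to Y$ with $x\,E\,y\iff f(x)\,F\,f(y)$ for all $x,y\in X$. Theorem. Let $G$ be a TSI Polish group, and let $H$ be a closed subgroup of the product $\prod_{m\in\mathbb N}H_m$ of a sequence of TSI strongly NSS Polish groups $H_m$. (1) If $E(G)\le_B E(H)$, then there exist a subgroup $W$ of $G$ which contains $G_0$ and is the intersection of countably many clopen subgroups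 of $G$, and a continuous homomorphism $S:W\to H$ such that $\ker(S)$ is non-archimedean. (2) Conversely, if there is a continuous homomorphism $S:G\to H$ such that $\ker(S)$ is non-archimedean and $S(G)$ is closed in $H$, and if the interval $[0,1]$ embeds topologically into $H$, then $E(G)\le_B E(H)$. -/

import Mathlib

open Filter Topology

/-- A topological group is TSI if its topology is induced by a metric that is invariant under
left and right translations. -/
def IsTSI (G : Type*) [Group G] [t : TopologicalSpace G] : Prop :=
  ∃ m : MetricSpace G,
    m.toPseudoMetricSpace.toUniformSpace.toTopologicalSpace = t ∧
      ∀ g h k : G, m.dist (g * h) (g * k) = m.dist h k ∧ m.dist (h * g) (k * g) = m.dist h k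

/-- `V` is an unenclosed set of `G`: an open neighbourhood of the identity such that every sequence
that does not converge to the identity has a finite product `g (n 0) * ⋯ * g (n k)` outside `V`,
with `n 0 < ⋯ < n k`. -/
def IsUnenclosed {G : Type*} [Group G] [TopologicalSpace G] (V : Set G) : Prop :=
  IsOpen V ∧ (1 : G) ∈ V ∧
    ∀ g : ℕ → G, ¬ Tendsto g atTop (𝓝 1) →
      ∃ (k : ℕ) (n : Fin (k + 1) → ℕ), StrictMono n ∧ (List.ofFn fun i => g (n i)).prod ∉ V

/-- A topological group is strongly NSS if it has an unenclosed set. -/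
def IsStronglyNSS (G : Type*) [Group G] [TopologicalSpace G] : Prop :=
  ∃ V : Set G, IsUnenclosed V

/-- The equivalence relation `E(G)` on `G ^ ℕ`: `x` and `y` are equivalent if
`x n * (y n)⁻¹` converges in `G`. -/
def inducedEquiv (G : Type*) [Group G] [TopologicalSpace G] [IsTopologicalGroup G] :
    Setoid (ℕ → G) where
  r x y := ∃ g : G, Tendsto (fun n => x n * (y n)⁻¹) atTop (𝓝 g)
  iseqv :=
    { refl := fun x => ⟨1, by simpa using tendsto_const_nhds⟩
      symm := by
        rintro x y ⟨g, hg⟩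
        exact ⟨g⁻¹, by simpa using hg.inv⟩
      trans := by
        rintro x y z ⟨g, hg⟩ ⟨h, hh⟩
        exact ⟨g * h, by simpa using hg.mul hh⟩ }

/-- Borel reducibility of equivalence relations: there is a Borel map `f` with
`x E y ↔ f x F f y`. -/
def BorelReducible {X Y : Type*} [TopologicalSpace X] [TopologicalSpace Y]
    (E : Setoid X) (F : Setoid Y) : Prop :=
  ∃ f : X → Y, @Measurable X Y (borel X) (borel Y) f ∧ ∀ x y : X, E.r x y ↔ F.r (f x) (f y)

/-! Part (1). A Borel reduction is continuous on a dense Gδ set. Multiplying by a generic sequence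
and repeating each entry over a long block turns it into a map Φ on sequences with entries in finite
sets F i, whose union contains a dense subgroup Γ (`exists_coding`). Up to an error 2⁻ᵏ, the values
of Φ before time N k depend only on the entries up to k, and the effect of a change that is a
constant left factor from k on has settled at time N k. So changes made in disjoint blocks act
almost independently (`Coding.ratio_local`), and a family of counterexamples can be concatenated
into one.

Concatenation shows first that small changes have small effects (`exists_forall_small`). Suppose
changes of size below a fixed ρ kept an effect of fixed size arbitrarily late. Then switching them
on in chosen blocks would realize, up to small errors, all finite ordered products of a sequence not
tending to 1, yet all these effects are small; strong NSS of H_m excludes this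
(`exists_forall_vanishing`). Hence each coordinate m has an open subgroup V_m such that elements of
Γ in one right coset of V_m can be exchanged at vanishing cost. For g in Γ ∩ V_m the effect of
multiplying all late entries by g converges to some S_m(g), and S_m extends to a continuous
homomorphism on V_m. Take W to be the intersection of the V_m and S = (S_m). Open subgroups are
clopen, so W contains G₀.

If the kernel were not non-archimedean, then for every ε it would contain a path with steps below ε
from 1 to a point outside a fixed ball. Walking along the path and back, late enough, has a small
effect at all times (`exists_forall_path`). Infinitely many such excursions with summable effects
give a divergent sequence x for which Φ(x)Φ(1)⁻¹ converges (`not_forall_exists_path`), contrary to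
the reduction.

Part (2). Put w_n = x_n y_n⁻¹. It converges as soon as S(w_n) converges and the distance from w_n to
w_{n+1} tends to 0: by the open mapping theorem w_n is close to a coset of the kernel, and a slow
drift in a non-archimedean group stays in a small open subgroup. By invariance the second condition
compares x_n⁻¹x_{n+1} with y_n⁻¹y_{n+1}. It is coded by a Lipschitz map to c₀ with coordinates in
[0,1], which the arc carries into H. -/

/-! ### Invariant distances, completeness and open mappings -/

/-- A two-sided invariant pseudo-distance on a group. -/
structure IsInvDist {G : Type*} [Group G] (δ : G → G → ℝ) : Prop where
  self : ∀ a, δ a a = 0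
  comm : ∀ a b, δ a b = δ b a
  triangle : ∀ a b c, δ a c ≤ δ a b + δ b c
  mul_left : ∀ g a b, δ (g * a) (g * b) = δ a b
  mul_right : ∀ g a b, δ (a * g) (b * g) = δ a b

namespace IsInvDist

variable {G : Type*} [Group G] {δ : G → G → ℝ}

theorem nonneg (h : IsInvDist δ) (a b : G) : 0 ≤ δ a b := by
  have h1 := h.triangle a b a
  rw [h.self, h.comm b a] at h1
  linarith

theorem mul_mul (h : IsInvDist δ) (a b c d : G) : δ (a * b) (c * d) ≤ δ a c + δ b d := by
  have h1 := h.triangle (a * b) (c * b) (c * d)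
  rwa [h.mul_right, h.mul_left] at h1

theorem inv_inv (h : IsInvDist δ) (a b : G) : δ a⁻¹ b⁻¹ = δ a b := by
  rw [← h.mul_left a a⁻¹ b⁻¹, ← h.mul_right b (a * a⁻¹)]
  simp [h.comm a b]

theorem div_div (h : IsInvDist δ) (a b c d : G) : δ (a * b⁻¹) (c * d⁻¹) ≤ δ a c + δ b d :=
  (h.mul_mul _ _ _ _).trans (by rw [h.inv_inv])

theorem div_one (h : IsInvDist δ) (a b : G) : δ (a * b⁻¹) 1 = δ a b := by
  rw [← h.mul_right b]
  simp

theorem inv_mul_one (h : IsInvDist δ) (a b : G) : δ (a⁻¹ * b) 1 = δ b a := by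
  rw [← h.mul_left a]
  simp

theorem inv_one (h : IsInvDist δ) (a : G) : δ a⁻¹ 1 = δ a 1 := by
  simpa using h.inv_inv a 1

theorem mul_one_le (h : IsInvDist δ) (a b : G) : δ (a * b) 1 ≤ δ a 1 + δ b 1 := by
  simpa using h.mul_mul a b 1 1

theorem comp (h : IsInvDist δ) {H : Type*} [Group H] (f : H →* G) :
    IsInvDist fun a b => δ (f a) (f b) where
  self a := h.self _
  comm a b := h.comm _ _
  triangle a b c := h.triangle _ _ _
  mul_left g a b := by simp [h.mul_left]
  mul_right g a b := by simp [h.mul_right]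

end IsInvDist

/-- A two-sided invariant distance inducing the topology of a group. -/
structure IsCompatDist {G : Type*} [Group G] [TopologicalSpace G] (δ : G → G → ℝ) : Prop
    extends IsInvDist δ where
  mem_nhds : ∀ (g : G) (s : Set G), s ∈ 𝓝 g ↔ ∃ ε > 0, ∀ h, δ h g < ε → h ∈ s

/-- Keeping the distance as a bare function leaves the given topology as the only topological
instance. -/
theorem IsTSI.exists_compatDist {G : Type*} [Group G] [t : TopologicalSpace G] (h : IsTSI G) :
    ∃ δ : G → G → ℝ, IsCompatDist δ := by
  obtain ⟨m, rfl, hm⟩ := h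
  refine ⟨m.dist, ⟨⟨?_, ?_, ?_, ?_, ?_⟩, ?_⟩⟩
  · exact m.dist_self
  · exact m.dist_comm
  · exact m.dist_triangle
  · exact fun g a b => (hm g a b).1
  · exact fun g a b => (hm g a b).2
  · exact fun g s => Metric.mem_nhds_iff

namespace IsCompatDist

variable {G : Type*} [Group G] [TopologicalSpace G] {δ : G → G → ℝ}

theorem ball_mem (h : IsCompatDist δ) (g : G) {ε : ℝ} (hε : 0 < ε) : {a | δ a g < ε} ∈ 𝓝 g :=
  (h.mem_nhds _ _).2 ⟨ε, hε, fun _ ha => ha⟩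

theorem tendsto_iff (h : IsCompatDist δ) {ι : Type*} {u : ι → G} {l : Filter ι} {g : G} :
    Tendsto u l (𝓝 g) ↔ ∀ ε > 0, ∀ᶠ i in l, δ (u i) g < ε := by
  constructor
  · exact fun hu ε hε => hu (h.ball_mem g hε)
  · intro hu s hs
    obtain ⟨ε, hε, hs⟩ := (h.mem_nhds _ _).1 hs
    exact (hu ε hε).mono fun i hi => hs _ hi

protected theorem continuous (h : IsCompatDist δ) : Continuous fun p : G × G => δ p.1 p.2 := by
  rw [continuous_iff_continuousAt]
  rintro ⟨a, b⟩
  rw [ContinuousAt, Metric.tendsto_nhds]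
  intro ε hε
  have h1 : ∀ᶠ p : G × G in 𝓝 (a, b), δ p.1 a < ε / 2 :=
    (continuous_fst.tendsto (a, b)).eventually (h.ball_mem a (half_pos hε))
  have h2 : ∀ᶠ p : G × G in 𝓝 (a, b), δ p.2 b < ε / 2 :=
    (continuous_snd.tendsto (a, b)).eventually (h.ball_mem b (half_pos hε))
  filter_upwards [h1, h2] with p hp1 hp2
  rw [Real.dist_eq, abs_lt]
  have t1 := h.triangle p.1 a p.2
  have t2 := h.triangle a b p.2
  have t3 := h.triangle a p.1 b
  have t4 := h.triangle p.1 p.2 b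
  rw [h.comm b] at t2
  rw [h.comm a p.1] at t3
  constructor <;> linarith

theorem isOpen_ball (h : IsCompatDist δ) (g : G) (ε : ℝ) : IsOpen {a | δ a g < ε} :=
  isOpen_lt (h.continuous.comp (continuous_id.prodMk continuous_const)) continuous_const

theorem eq_of_dist [T1Space G] (h : IsCompatDist δ) {a b : G} (hab : ∀ ε > 0, δ a b < ε) :
    a = b := by
  by_contra hne
  obtain ⟨ε, hε, hs⟩ := (h.mem_nhds b {a}ᶜ).1 (isOpen_compl_singleton.mem_nhds (Ne.symm hne))
  exact hs a (hab ε hε) rfl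

/-- A compatible two-sided invariant distance on a Polish group is complete. -/
theorem exists_tendsto [PolishSpace G] (h : IsCompatDist δ) (x : ℕ → G)
    (hx : ∀ ε > 0, ∃ N, ∀ n ≥ N, δ (x n) (x N) < ε) : ∃ g, Tendsto x atTop (𝓝 g) := by
  let _ := TopologicalSpace.upgradeIsCompletelyMetrizable G
  have hmulR : ∀ a : G, Continuous fun b : G => b * a := by
    intro a
    rw [continuous_iff_continuousAt]
    intro b
    rw [ContinuousAt, h.tendsto_iff]
    intro ε hε
    filter_upwards [h.ball_mem b hε] with c hc
    rwa [h.mul_right]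
  -- Baire category: for g in every `D k`, a δ-ball containing a tail of x n * g is small in the
  -- complete metric, so x n * g converges there.
  let D : ℕ → Set G := fun k => {g | ∃ N, ∃ ρ > 0, (∀ n ≥ N, δ (x n) (x N) < ρ) ∧
    ∀ a, δ a (x N * g) < 2 * ρ → dist a (x N * g) < 1 / ((k : ℝ) + 1)}
  have hD : ∀ k, Dense (interior (D k)) := by
    intro k g₀
    rw [mem_closure_iff_nhds]
    intro s hs
    obtain ⟨η, hη, hs⟩ := (h.mem_nhds _ _).1 hs
    obtain ⟨N, hN⟩ := hx η hη
    have hk : (0 : ℝ) < 1 / ((k : ℝ) + 1) / 2 := by positivity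
    obtain ⟨ρ, hρ, hρ'⟩ := (h.mem_nhds (x N * g₀) _).1
      (Metric.ball_mem_nhds (x N * g₀) hk)
    obtain ⟨N₁, hN₁⟩ := hx (ρ / 3 / 2) (by positivity)
    obtain ⟨n, hn, hn'⟩ : ∃ n, n ≥ N ∧ n ≥ N₁ := ⟨max N N₁, le_max_left _ _, le_max_right _ _⟩
    have htail : ∀ i ≥ n, δ (x i) (x n) < ρ / 3 := by
      intro i hi
      have h1 := hN₁ i (le_trans hn' hi)
      have h2 := hN₁ n hn'
      have h3 := h.triangle (x i) (x N₁) (x n)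
      rw [h.comm (x N₁)] at h3
      linarith
    -- Left multiplication by x n sends this point to x N * g₀, around which a small δ-ball was
    -- already chosen.
    refine ⟨(x n)⁻¹ * x N * g₀, hs _ ?_, ?_⟩
    · have h1 := h.mul_right g₀ ((x n)⁻¹ * x N) 1
      rw [one_mul] at h1
      rw [h1, h.inv_mul_one, h.comm]
      exact hN n hn
    · rw [mem_interior_iff_mem_nhds]
      refine Filter.mem_of_superset (h.ball_mem _ (show 0 < ρ / 3 by positivity)) ?_
      intro g hg
      have hg1 : δ (x n * g) (x N * g₀) < ρ / 3 := by
        have h1 := h.mul_left (x n) g ((x n)⁻¹ * x N * g₀)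
        rw [show x n * ((x n)⁻¹ * x N * g₀) = x N * g₀ by group] at h1
        rw [h1]
        exact hg
      refine ⟨n, ρ / 3, by positivity, htail, fun a ha => ?_⟩
      have h1 : dist a (x N * g₀) < _ := hρ' a (by
        have := h.triangle a (x n * g) (x N * g₀)
        linarith)
      have h2 : dist (x n * g) (x N * g₀) < _ := hρ' (x n * g) (by linarith)
      have h3 := dist_triangle_right a (x n * g) (x N * g₀)
      linarith
  obtain ⟨g, hg⟩ : (⋂ k, interior (D k)).Nonempty :=
    (dense_iInter_of_isOpen (fun k => isOpen_interior) hD).nonempty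
  have hc : CauchySeq fun n => x n * g := by
    rw [Metric.cauchySeq_iff']
    intro ε hε
    obtain ⟨k, hk⟩ := exists_nat_one_div_lt hε
    obtain ⟨N, ρ, hρ, h1, h2⟩ := interior_subset (Set.mem_iInter.1 hg k)
    refine ⟨N, fun n hn => (h2 _ ?_).trans hk⟩
    rw [h.mul_right]
    linarith [h1 n hn]
  obtain ⟨a, ha⟩ := cauchySeq_tendsto_of_complete hc
  refine ⟨a * g⁻¹, ?_⟩
  have := ((hmulR g⁻¹).tendsto a).comp ha
  simpa [Function.comp_def] using this

end IsCompatDist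

/-- Open mapping theorem: an element whose image is close to the identity is close to the kernel. -/
theorem IsCompatDist.exists_map_eq_of_isClosed_range {G H : Type*} [Group G] [TopologicalSpace G]
    [IsTopologicalGroup G] [PolishSpace G] [Group H] [TopologicalSpace H] [IsTopologicalGroup H]
    [PolishSpace H] {δ : G → G → ℝ} (h : IsCompatDist δ) (S : G →* H) (hS : Continuous S)
    (hr : IsClosed (Set.range S)) {ε : ℝ} (hε : 0 < ε) :
    ∀ᶠ a in 𝓝 (1 : H), a ∈ Set.range S → ∃ g, S g = a ∧ δ g 1 < ε := by
  -- Countably many translates of the half-size ball cover G, so by Baire the closure of one image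
  -- has interior in the range; quotients of its points fill a neighbourhood of 1 there.
  have hcl : ∀ r > 0, ∀ᶠ a in 𝓝 (1 : H), a ∈ Set.range S → a ∈ closure (S '' {g | δ g 1 < r}) := by
    intro r hr0
    obtain ⟨γ, hγ⟩ := TopologicalSpace.exists_dense_seq G
    have hP : PolishSpace (Set.range S) := hr.isClosedEmbedding_subtypeVal.polishSpace
    let _ := TopologicalSpace.upgradeIsCompletelyMetrizable (Set.range S)
    have : Nonempty (Set.range S) := ⟨⟨S 1, 1, rfl⟩⟩
    obtain ⟨i, ⟨b, hb⟩, hi⟩ := nonempty_interior_of_iUnion_of_closed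
      (f := fun i : ℕ => (Subtype.val ⁻¹' closure (S '' {g | δ g (γ i) < r / 2}) :
        Set (Set.range S)))
      (fun i => isClosed_closure.preimage continuous_subtype_val) (by
        rw [Set.eq_univ_iff_forall]
        rintro ⟨_, g, rfl⟩
        obtain ⟨i, hi⟩ := hγ.exists_mem_open (h.isOpen_ball g (r / 2)) ⟨g, by
          simpa [h.self] using hr0⟩
        exact Set.mem_iUnion.2 ⟨i, subset_closure ⟨g, by
          simpa [h.comm g] using hi, rfl⟩⟩)
    rw [mem_interior_iff_mem_nhds, nhds_subtype_eq_comap, mem_comap] at hi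
    obtain ⟨O, hO, hOs⟩ := hi
    have hcont : Tendsto (fun a : H => a * b) (𝓝 1) (𝓝 b) := by
      simpa using (continuous_mul_const b).tendsto 1
    obtain ⟨g₀, rfl⟩ := hb
    filter_upwards [hcont hO] with a ha hra
    obtain ⟨g, rfl⟩ := hra
    have h1 : S g * S g₀ ∈ closure (S '' {g | δ g (γ i) < r / 2}) :=
      hOs (show (⟨S g * S g₀, g * g₀, by simp⟩ : Set.range S) ∈ Subtype.val ⁻¹' O from ha)
    have h2 : S g₀ ∈ closure (S '' {g | δ g (γ i) < r / 2}) :=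
      hOs (show (⟨S g₀, g₀, rfl⟩ : Set.range S) ∈ Subtype.val ⁻¹' O from
        (mem_of_mem_nhds hO : S g₀ ∈ O))
    have h3 := map_mem_closure₂ (f := fun a b : H => a * b⁻¹) (by fun_prop)
      (u := S '' {g | δ g 1 < r}) h1 h2 (by
        rintro _ ⟨a, ha, rfl⟩ _ ⟨b, hb, rfl⟩
        refine ⟨a * b⁻¹, ?_, by simp⟩
        change δ a (γ i) < r / 2 at ha
        change δ b (γ i) < r / 2 at hb
        change δ (a * b⁻¹) 1 < r
        rw [h.div_one]
        have := h.triangle a (γ i) b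
        rw [h.comm (γ i)] at this
        linarith)
    simpa using h3
  have hstep : ∀ n : ℕ, ∃ O ∈ 𝓝 (1 : H), ∀ a ∈ O, a ∈ Set.range S →
      a ∈ closure (S '' {g | δ g 1 < ε / 2 / 2 / 2 ^ n}) := by
    intro n
    exact (hcl (ε / 2 / 2 / 2 ^ n) (by positivity)).exists_mem
  choose O hO hOcl using hstep
  filter_upwards [hO 0] with a ha hra
  -- Successive approximation: step n moves by less than ε/4 · 2⁻ⁿ and brings the remaining error
  -- into the next neighbourhood.
  have hnext : ∀ (n : ℕ) (g : G), S g⁻¹ * a ∈ O n → ∃ g', δ g' g < ε / 2 / 2 / 2 ^ n ∧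
      S g'⁻¹ * a ∈ O (n + 1) := by
    intro n g hg
    have hmem := hOcl n _ hg (by
      obtain ⟨c, rfl⟩ := hra
      exact ⟨g⁻¹ * c, by simp⟩)
    have hT : Tendsto (fun b : H => b⁻¹ * (S g⁻¹ * a)) (𝓝 (S g⁻¹ * a)) (𝓝 1) := by
      have : Continuous fun b : H => b⁻¹ * (S g⁻¹ * a) := by fun_prop
      simpa using this.tendsto (S g⁻¹ * a)
    obtain ⟨_, hb, c, hc, rfl⟩ := mem_closure_iff_nhds.1 hmem _ (hT (hO (n + 1)))
    refine ⟨g * c, ?_, by simpa [mul_assoc] using hb⟩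
    have := h.mul_left g c 1
    rw [mul_one] at this
    rw [this]
    exact hc
  choose! nx hnx1 hnx2 using hnext
  let u : ℕ → G := fun n => Nat.rec 1 (fun n g => nx n g) n
  have hu : ∀ n, S (u n)⁻¹ * a ∈ O n := by
    intro n
    induction n with
    | zero => simpa [u] using ha
    | succ n ih => exact hnx2 n _ ih
  have hud : ∀ n, δ (u (n + 1)) (u n) < ε / 2 / 2 / 2 ^ n := fun n => hnx1 n _ (hu n)
  have hsum : ∀ n k, δ (u (n + k)) (u n) ≤ ε / 2 / 2 ^ n - ε / 2 / 2 ^ (n + k) := by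
    intro n k
    induction k with
    | zero => simp [h.self]
    | succ k ih =>
      have h1 := h.triangle (u (n + (k + 1))) (u (n + k)) (u n)
      have h2 := (hud (n + k)).le
      have h3 : ε / 2 / 2 / 2 ^ (n + k) = ε / 2 / 2 ^ (n + k) - ε / 2 / 2 ^ (n + (k + 1)) := by
        rw [← add_assoc, pow_succ]
        field_simp
        ring
      rw [← add_assoc] at h1 ⊢
      rw [← add_assoc] at h3
      linarith
  have hpos : ∀ n, 0 < ε / 2 / 2 ^ n := fun n => by positivity
  have hlim : Tendsto (fun n : ℕ => ε / 2 / 2 ^ n) atTop (𝓝 0) := by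
    have := (tendsto_pow_atTop_nhds_zero_of_lt_one (by norm_num)
      (by norm_num : (1 / 2 : ℝ) < 1)).const_mul (ε / 2)
    simpa [div_eq_mul_inv] using this
  obtain ⟨g, hg⟩ := h.exists_tendsto u (by
    intro η hη
    obtain ⟨N, hN⟩ := (hlim.eventually_lt_const hη).exists
    refine ⟨N, fun n hn => ?_⟩
    obtain ⟨k, rfl⟩ := Nat.exists_eq_add_of_le hn
    have := hsum N k
    have := hpos (N + k)
    linarith)
  refine ⟨g, ?_, ?_⟩
  · have h1 : Tendsto (fun n => S (u n)⁻¹ * a) atTop (𝓝 (S g⁻¹ * a)) :=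
      ((hS.tendsto _).comp hg.inv).mul_const a
    -- The errors lie in closures of images of shrinking balls, which continuity of S puts inside
    -- any closed neighbourhood of 1.
    have h2 : Tendsto (fun n => S (u n)⁻¹ * a) atTop (𝓝 1) := by
      rw [(closed_nhds_basis (1 : H)).tendsto_right_iff]
      rintro s ⟨hs, hsc⟩
      obtain ⟨η, hη, hsη⟩ := (h.mem_nhds 1 (S ⁻¹' s)).1 (hS.tendsto' 1 1 (map_one S) hs)
      filter_upwards [hlim.eventually_lt_const hη] with n hn
      refine hsc.closure_subset_iff.2 ?_ (hOcl n _ (hu n) ?_)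
      · rintro _ ⟨c, hc, rfl⟩
        exact hsη c ((show δ c 1 < _ from hc).trans (by
          have := hpos n
          rw [div_right_comm]
          linarith))
      · obtain ⟨c, rfl⟩ := hra
        exact ⟨(u n)⁻¹ * c, by simp⟩
    have h3 := tendsto_nhds_unique h1 h2
    rw [map_inv, inv_mul_eq_one] at h3
    exact h3
  · obtain ⟨n, hn⟩ := (h.tendsto_iff.1 hg (ε / 4) (by positivity)).exists
    have h1 := hsum 0 n
    have h2 := h.triangle g (u n) 1
    have h3 := hpos (0 + n)
    rw [h.comm g (u n)] at h2
    simp only [zero_add, pow_zero, div_one] at h1 h3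
    change δ (u n) 1 ≤ _ at h1
    linarith

/-! ### A Lipschitz coding of a separable group by null arrays -/

/-- A Lipschitz bump function around a point. -/
noncomputable def bump {G : Type*} (δ : G → G → ℝ) (r : ℝ) (a b : G) : ℝ :=
  max 0 (min 1 (2 - δ b a / r))

/-- The largest value of the first bump functions. -/
noncomputable def bumpSup {G : Type*} (δ : G → G → ℝ) (γ : ℕ → G) (r : ℝ) : ℕ → G → ℝ
  | 0, _ => 0
  | i + 1, b => max (bumpSup δ γ r i b) (bump δ r (γ i) b)

/-- The coordinates of a map of a separable metric group to `c₀`. -/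
noncomputable def coord {G : Type*} (δ : G → G → ℝ) (γ : ℕ → G) (r : ℝ) (i : ℕ) (b : G) : ℝ :=
  min (bump δ r (γ i) b) (1 - bumpSup δ γ r i b)

section Coord

variable {G : Type*} {δ : G → G → ℝ} {γ : ℕ → G} {r : ℝ}

theorem bump_nonneg (a b : G) : 0 ≤ bump δ r a b := le_max_left _ _

theorem bump_le_one (a b : G) : bump δ r a b ≤ 1 := max_le zero_le_one (min_le_left _ _)

theorem bumpSup_le_one (i : ℕ) (b : G) : bumpSup δ γ r i b ≤ 1 := by
  induction i with
  | zero => exact zero_le_one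
  | succ i ih => exact max_le ih (bump_le_one _ _)

theorem coord_nonneg (i : ℕ) (b : G) : 0 ≤ coord δ γ r i b :=
  le_min (bump_nonneg _ _) (by linarith [bumpSup_le_one (δ := δ) (γ := γ) (r := r) i b])

theorem coord_le_one (i : ℕ) (b : G) : coord δ γ r i b ≤ 1 :=
  (min_le_left _ _).trans (bump_le_one _ _)

theorem bump_lipschitz [Group G] (h : IsInvDist δ) (hr : 0 < r) (a b c : G) :
    |bump δ r a b - bump δ r a c| ≤ δ b c / r := by
  have h0 : 0 ≤ δ b c / r := div_nonneg (h.nonneg b c) hr.le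
  have h1 : |(2 - δ b a / r) - (2 - δ c a / r)| ≤ δ b c / r := by
    have t1 := h.triangle b c a
    have t2 := h.triangle c b a
    rw [h.comm c b] at t2
    rw [show (2 - δ b a / r) - (2 - δ c a / r) = (δ c a - δ b a) / r by ring, abs_div,
      abs_of_pos hr]
    gcongr
    rw [abs_le]
    constructor <;> linarith
  refine (abs_max_sub_max_le_max _ _ _ _).trans (max_le (by simpa using h0) ?_)
  exact (abs_min_sub_min_le_max _ _ _ _).trans (max_le (by simpa using h0) h1)

theorem bumpSup_lipschitz [Group G] (h : IsInvDist δ) (hr : 0 < r) (i : ℕ) (b c : G) :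
    |bumpSup δ γ r i b - bumpSup δ γ r i c| ≤ δ b c / r := by
  induction i with
  | zero => simpa [bumpSup] using div_nonneg (h.nonneg b c) hr.le
  | succ i ih =>
    exact (abs_max_sub_max_le_max _ _ _ _).trans (max_le ih (bump_lipschitz h hr _ _ _))

theorem coord_lipschitz [Group G] (h : IsInvDist δ) (hr : 0 < r) (i : ℕ) (b c : G) :
    |coord δ γ r i b - coord δ γ r i c| ≤ δ b c / r := by
  refine (abs_min_sub_min_le_max _ _ _ _).trans (max_le (bump_lipschitz h hr _ _ _) ?_)
  rw [sub_sub_sub_cancel_left, abs_sub_comm]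
  exact bumpSup_lipschitz h hr _ _ _

theorem bump_le_bumpSup {i j : ℕ} (hij : i < j) (b : G) :
    bump δ r (γ i) b ≤ bumpSup δ γ r j b := by
  induction j, hij using Nat.le_induction with
  | base => exact le_max_right _ _
  | succ j _ ih => exact ih.trans (le_max_left _ _)

theorem bump_eq_one (hr : 0 < r) {a b : G} (hab : δ b a < r) : bump δ r a b = 1 := by
  have : δ b a / r ≤ 1 := (div_le_one hr).2 hab.le
  rw [bump, min_eq_left (by linarith), max_eq_right zero_le_one]

theorem lt_of_bump_pos (hr : 0 < r) {a b : G} (hab : 0 < bump δ r a b) : δ b a < 2 * r := by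
  by_contra hc
  have : 2 ≤ δ b a / r := (le_div_iff₀ hr).2 (not_lt.1 hc)
  rw [bump, max_eq_left ((min_le_right _ _).trans (by linarith))] at hab
  exact lt_irrefl _ hab

theorem bumpSup_le {i : ℕ} {b : G} {c : ℝ} (hc : 0 ≤ c) (h : ∀ j < i, bump δ r (γ j) b ≤ c) :
    bumpSup δ γ r i b ≤ c := by
  induction i with
  | zero => exact hc
  | succ i ih => exact max_le (ih fun j hj => h j (by omega)) (h i (by omega))

/-- Once some γ i is within r of b, its bump equals 1 and leaves no room for later coordinates.
Hence only finitely many coordinates of a point are nonzero. -/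
theorem coord_eq_zero (hr : 0 < r) {i j : ℕ} {b : G} (hi : δ b (γ i) < r) (hij : i < j) :
    coord δ γ r j b = 0 := by
  have h1 := bump_le_bumpSup (δ := δ) (γ := γ) (r := r) hij b
  rw [bump_eq_one hr hi] at h1
  exact le_antisymm ((min_le_right _ _).trans (by linarith)) (coord_nonneg _ _)

/-- Take the first bump exceeding 1/2 at b: the earlier ones leave room 1/2 for its coordinate,
while c is too far away to meet its support, of radius 2r. -/
theorem exists_half_le_coord_sub [Group G] (h : IsInvDist δ) (hr : 0 < r) {b c : G}
    (hb : ∃ i, δ b (γ i) < r) (hbc : 4 * r ≤ δ b c) :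
    ∃ i, 1 / 2 ≤ |coord δ γ r i b - coord δ γ r i c| := by
  classical
  have hex : ∃ i, 1 / 2 < bump δ r (γ i) b := by
    obtain ⟨i, hi⟩ := hb
    exact ⟨i, by rw [bump_eq_one hr hi]; norm_num⟩
  let i := Nat.find hex
  have hi : 1 / 2 < bump δ r (γ i) b := Nat.find_spec hex
  have h1 : bumpSup δ γ r i b ≤ 1 / 2 :=
    bumpSup_le (by norm_num) fun j hj => not_lt.1 (Nat.find_min hex hj)
  have h2 : 1 / 2 ≤ coord δ γ r i b := le_min hi.le (by linarith)
  have h3 : coord δ γ r i c = 0 := by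
    refine le_antisymm ((min_le_left _ _).trans ?_) (coord_nonneg _ _)
    by_contra hc
    have h4 := lt_of_bump_pos hr (not_le.1 hc)
    have h5 := lt_of_bump_pos hr (lt_trans (by norm_num) hi)
    have h6 := h.triangle b (γ i) c
    rw [h.comm (γ i) c] at h6
    linarith
  refine ⟨i, ?_⟩
  rw [h3, sub_zero]
  exact h2.trans (le_abs_self _)

end Coord

/-- Weighted coordinates at all scales. -/
noncomputable def scaledCoord {G : Type*} (δ : G → G → ℝ) (γ : ℕ → G) (q : ℕ × ℕ) (b : G) : ℝ :=
  (1 / 2) ^ q.1 * coord δ γ ((1 / 2) ^ q.1) q.2 b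

section ScaledCoord

variable {G : Type*} {δ : G → G → ℝ} {γ : ℕ → G}

theorem scaledCoord_mem (q : ℕ × ℕ) (b : G) : scaledCoord δ γ q b ∈ Set.Icc (0 : ℝ) 1 :=
  ⟨mul_nonneg (by positivity) (coord_nonneg _ _),
    mul_le_one₀ (pow_le_one₀ (by norm_num) (by norm_num)) (coord_nonneg _ _) (coord_le_one _ _)⟩

theorem scaledCoord_le (q : ℕ × ℕ) (b : G) : scaledCoord δ γ q b ≤ (1 / 2) ^ q.1 :=
  mul_le_of_le_one_right (by positivity) (coord_le_one _ _)

theorem scaledCoord_lipschitz [Group G] (h : IsInvDist δ) (q : ℕ × ℕ) (b c : G) :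
    |scaledCoord δ γ q b - scaledCoord δ γ q c| ≤ δ b c := by
  have hr : (0 : ℝ) < (1 / 2) ^ q.1 := by positivity
  rw [scaledCoord, scaledCoord, ← mul_sub, abs_mul, abs_of_pos hr]
  have := mul_le_mul_of_nonneg_left (coord_lipschitz (γ := γ) h hr q.2 b c) hr.le
  rwa [mul_div_cancel₀ _ hr.ne'] at this

theorem continuous_scaledCoord [Group G] [TopologicalSpace G] (h : IsCompatDist δ) (q : ℕ × ℕ) :
    Continuous (scaledCoord δ γ q) := by
  rw [continuous_iff_continuousAt]
  intro b
  rw [ContinuousAt, Metric.tendsto_nhds]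
  intro ε hε
  filter_upwards [h.ball_mem b hε] with c hc
  exact (scaledCoord_lipschitz h.toIsInvDist q c b).trans_lt hc

/-- The factor 2⁻ᵏ at scale k makes the coordinates 1-Lipschitz and uniformly small at fine scales.
Thus only finitely many n, k and i can contribute a given error, while distance 4 · 2⁻ᵏ is detected
at scale k. -/
theorem finite_le_scaledCoord_sub_iff [Group G] (h : IsInvDist δ)
    (hγ : ∀ b, ∀ r > 0, ∃ i, δ b (γ i) < r)
    (b c : ℕ → G) :
    (∀ ε > 0, {q : ℕ × ℕ × ℕ |
        ε ≤ |scaledCoord δ γ q.2 (b q.1) - scaledCoord δ γ q.2 (c q.1)|}.Finite) ↔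
      ∀ ε > 0, ∀ᶠ n in atTop, δ (b n) (c n) < ε := by
  constructor
  · intro hf ε hε
    obtain ⟨k, hk⟩ := exists_pow_lt_of_lt_one (show 0 < ε / 4 by positivity)
      (by norm_num : (1 / 2 : ℝ) < 1)
    have hr : (0 : ℝ) < (1 / 2) ^ k := by positivity
    have hfin := (hf ((1 / 2) ^ k * (1 / 2)) (by positivity)).image Prod.fst
    rw [← Nat.cofinite_eq_atTop]
    filter_upwards [hfin.compl_mem_cofinite] with n hn
    by_contra hc
    obtain ⟨i, hi⟩ :=
      exists_half_le_coord_sub (γ := γ) (c := c n) h hr (hγ (b n) _ hr) (by linarith)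
    refine hn ⟨(n, k, i), ?_, rfl⟩
    change ((1 / 2) ^ k * (1 / 2) : ℝ) ≤ |(1 / 2) ^ k * _ - (1 / 2) ^ k * _|
    rw [← mul_sub, abs_mul, abs_of_pos hr]
    exact mul_le_mul_of_nonneg_left hi hr.le
  · intro hd ε hε
    obtain ⟨N, hN⟩ := eventually_atTop.1 (hd ε hε)
    obtain ⟨K, hK⟩ := exists_pow_lt_of_lt_one hε (by norm_num : (1 / 2 : ℝ) < 1)
    choose I hI using fun (b : G) (k : ℕ) =>
      hγ b ((1 / 2) ^ k) (by positivity)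
    refine Set.Finite.subset ((Set.finite_lt_nat N).biUnion fun n _ =>
      (Set.finite_lt_nat K).biUnion fun k _ =>
        ((Set.finite_le_nat (max (I (b n) k) (I (c n) k))).image fun i => (n, k, i))) ?_
    rintro ⟨n, k, i⟩ hq
    change ε ≤ |scaledCoord δ γ (k, i) (b n) - scaledCoord δ γ (k, i) (c n)| at hq
    simp only [Set.mem_iUnion]
    have hn : n < N := by
      by_contra hn
      have := hN n (not_lt.1 hn)
      have := scaledCoord_lipschitz (γ := γ) h (k, i) (b n) (c n)
      linarith
    have hk : k < K := by
      by_contra hk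
      have h1 : (1 / 2 : ℝ) ^ k ≤ (1 / 2) ^ K :=
        pow_le_pow_of_le_one (by norm_num) (by norm_num) (not_lt.1 hk)
      have h2 := scaledCoord_le (δ := δ) (γ := γ) (k, i) (b n)
      have h3 := scaledCoord_le (δ := δ) (γ := γ) (k, i) (c n)
      have h4 := (scaledCoord_mem (δ := δ) (γ := γ) (k, i) (b n)).1
      have h5 := (scaledCoord_mem (δ := δ) (γ := γ) (k, i) (c n)).1
      have h6 := abs_sub_le_of_nonneg_of_le h4 (h2.trans h1) h5 (h3.trans h1)
      linarith
    refine ⟨n, hn, k, hk, i, ?_, rfl⟩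
    by_contra hi
    rw [Set.mem_ofPred_eq, not_le, max_lt_iff] at hi
    have hr : (0 : ℝ) < (1 / 2) ^ k := by positivity
    rw [scaledCoord, scaledCoord, coord_eq_zero hr (hI _ _) hi.1,
      coord_eq_zero hr (hI _ _) hi.2] at hq
    simp at hq
    linarith

end ScaledCoord

/-! ### The reduction of part (2) -/

/-- The image under A of the compact set where B avoids a neighbourhood of b is closed and misses a.
-/
theorem tendsto_of_tendsto_of_compact {C Y Z ι : Type*} [TopologicalSpace C] [CompactSpace C]
    [TopologicalSpace Y] [T2Space Y] [TopologicalSpace Z] {A : C → Y} {B : C → Z}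
    (hA : Continuous A) (hB : Continuous B) {a : Y} {b : Z} (hab : ∀ c, A c = a → B c = b)
    {u : ι → C} {l : Filter ι} (hu : Tendsto (A ∘ u) l (𝓝 a)) : Tendsto (B ∘ u) l (𝓝 b) := by
  rw [tendsto_nhds]
  intro O hO hb
  have hK : IsClosed (A '' (B ⁻¹' O)ᶜ) :=
    ((hO.preimage hB).isClosed_compl.isCompact.image hA).isClosed
  have ha : a ∈ (A '' (B ⁻¹' O)ᶜ)ᶜ := by
    rintro ⟨c, hc, hca⟩
    exact hc (by rw [Set.mem_preimage, hab c hca]; exact hb)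
  filter_upwards [hu (hK.isOpen_compl.mem_nhds ha)] with i hi
  by_contra hc
  exact hi ⟨u i, hc, rfl⟩

/-- On the compact square both e(s)e(t)⁻¹ = 1 and |s − t| = 0 define the diagonal, so the two kinds
of closeness agree uniformly. -/
theorem tendsto_mul_inv_iff_of_embedding {H ι : Type*} [Group H] [TopologicalSpace H]
    [IsTopologicalGroup H] [T2Space H] {e : Set.Icc (0 : ℝ) 1 → H} (he : IsEmbedding e)
    {s t : ι → Set.Icc (0 : ℝ) 1} {l : Filter ι} :
    Tendsto (fun i => e (s i) * (e (t i))⁻¹) l (𝓝 1) ↔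
      Tendsto (fun i => |(s i : ℝ) - t i|) l (𝓝 0) := by
  have hA : Continuous fun c : Set.Icc (0 : ℝ) 1 × Set.Icc (0 : ℝ) 1 => e c.1 * (e c.2)⁻¹ :=
    (he.continuous.comp continuous_fst).mul (he.continuous.comp continuous_snd).inv
  have hB : Continuous fun c : Set.Icc (0 : ℝ) 1 × Set.Icc (0 : ℝ) 1 => |(c.1 : ℝ) - c.2| := by
    fun_prop
  constructor
  · intro h
    refine tendsto_of_tendsto_of_compact (u := fun i => (s i, t i)) hA hB ?_ h
    rintro ⟨c, d⟩ hcd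
    rw [mul_inv_eq_one] at hcd
    have : c = d := he.injective hcd
    simp [this]
  · intro h
    refine tendsto_of_tendsto_of_compact (u := fun i => (s i, t i)) hB hA ?_ h
    rintro ⟨c, d⟩ hcd
    have : c = d := by
      rw [Subtype.ext_iff]
      simpa [sub_eq_zero] using hcd
    simp [this]

theorem inducedEquiv_rel {G : Type*} [Group G] [TopologicalSpace G] [IsTopologicalGroup G]
    (x y : ℕ → G) :
    (inducedEquiv G).r x y ↔ ∃ g : G, Tendsto (fun n => x n * (y n)⁻¹) atTop (𝓝 g) :=
  Iff.rfl

/-- A slowly varying sequence whose image under a homomorphism with closed range and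
non-archimedean kernel converges is itself convergent. -/
theorem IsCompatDist.exists_tendsto_of_map {G H : Type*} [Group G] [TopologicalSpace G]
    [IsTopologicalGroup G] [PolishSpace G] [Group H] [TopologicalSpace H] [IsTopologicalGroup H]
    [PolishSpace H] {δ : G → G → ℝ} (h : IsCompatDist δ) (S : G →* H) (hS : Continuous S)
    (hker : NonarchimedeanGroup S.ker) (hr : IsClosed (Set.range S)) {w : ℕ → G}
    (hw : ∀ ε > 0, ∀ᶠ n in atTop, δ (w (n + 1)) (w n) < ε) {a : H}
    (ha : Tendsto (fun n => S (w n)) atTop (𝓝 a)) : ∃ g, Tendsto w atTop (𝓝 g) := by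
  obtain ⟨g, rfl⟩ := hr.mem_of_tendsto ha (Eventually.of_forall fun n => ⟨w n, rfl⟩)
  have h1 : Tendsto (fun n => S (w n * g⁻¹)) atTop (𝓝 1) := by
    simpa using ha.mul_const (S g)⁻¹
  -- If c is a small preimage of S (w n * g⁻¹), then c⁻¹ * (w n * g⁻¹) is a nearby kernel element.
  have hν : ∀ ε > 0, ∀ᶠ n in atTop, ∃ ν ∈ S.ker, δ ν (w n * g⁻¹) < ε := by
    intro ε hε
    filter_upwards [h1.eventually (h.exists_map_eq_of_isClosed_range S hS hr hε)] with n hn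
    obtain ⟨c, hc, hc1⟩ := hn ⟨_, rfl⟩
    refine ⟨c⁻¹ * (w n * g⁻¹), by rw [MonoidHom.mem_ker, map_mul, map_inv, hc]; simp, ?_⟩
    have := h.mul_right (w n * g⁻¹) c⁻¹ 1
    rw [one_mul] at this
    rw [this, h.inv_one]
    exact hc1
  apply h.exists_tendsto
  intro ε hε
  have hball : {k : S.ker | δ k 1 < ε / 3} ∈ 𝓝 (1 : S.ker) :=
    continuous_subtype_val.tendsto' (1 : S.ker) (1 : G) rfl (h.ball_mem 1 (by positivity))
  obtain ⟨V, hV⟩ := hker.is_nonarchimedean _ hball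
  have hV1 : (V : Set S.ker) ∈ 𝓝 (1 : S.ker) := V.isOpen.mem_nhds V.one_mem
  rw [nhds_subtype_eq_comap, mem_comap] at hV1
  obtain ⟨O, hO, hOV⟩ := hV1
  obtain ⟨ρ, hρ, hρO⟩ := (h.mem_nhds _ _).1 hO
  obtain ⟨N, hN⟩ := eventually_atTop.1 ((hν (min (ε / 3) (ρ / 3)) (by positivity)).and
    (hw (ρ / 3) (by positivity)))
  choose! ν hν1 hν2 using fun n (hn : n ≥ N) => (hN n hn).1
  -- Consecutive quotients of the ν lie in the open subgroup V, hence so do their products: the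
  -- drift never leaves the ball containing V.
  have hmem : ∀ k, (⟨ν (N + k) * (ν N)⁻¹, S.ker.mul_mem (hν1 _ (by omega))
      (S.ker.inv_mem (hν1 _ le_rfl))⟩ : S.ker) ∈ V := by
    intro k
    induction k with
    | zero =>
      have h4 : (⟨1, S.ker.one_mem⟩ : S.ker) ∈ V := V.one_mem
      simpa only [add_zero, mul_inv_cancel] using h4
    | succ k ih =>
      have h2 : (⟨ν (N + k + 1) * (ν (N + k))⁻¹, S.ker.mul_mem (hν1 _ (by omega))
          (S.ker.inv_mem (hν1 _ (by omega)))⟩ : S.ker) ∈ V := by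
        apply hOV
        apply hρO
        change δ (ν (N + k + 1) * (ν (N + k))⁻¹) 1 < ρ
        rw [h.div_one]
        have t1 := h.triangle (ν (N + k + 1)) (w (N + k + 1) * g⁻¹) (ν (N + k))
        have t2 := h.triangle (w (N + k + 1) * g⁻¹) (w (N + k) * g⁻¹) (ν (N + k))
        have t3 := (hν2 (N + k + 1) (by omega)).trans_le (min_le_right _ _)
        have t4 := (hν2 (N + k) (by omega)).trans_le (min_le_right _ _)
        have t5 := (hN (N + k) (by omega)).2
        rw [h.mul_right, h.comm (w (N + k) * g⁻¹)] at t2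
        linarith
      have h3 := V.mul_mem h2 ih
      have h4 : (⟨ν (N + k + 1) * (ν (N + k))⁻¹ * (ν (N + k) * (ν N)⁻¹), S.ker.mul_mem
          (S.ker.mul_mem (hν1 _ (by omega)) (S.ker.inv_mem (hν1 _ (by omega))))
          (S.ker.mul_mem (hν1 _ (by omega)) (S.ker.inv_mem (hν1 _ le_rfl)))⟩ : S.ker) ∈ V := h3
      simp only [inv_mul_cancel_right, ← mul_assoc] at h4
      exact h4
  refine ⟨N, fun n hn => ?_⟩
  obtain ⟨k, rfl⟩ := Nat.exists_eq_add_of_le hn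
  have t1 : δ (ν (N + k) * (ν N)⁻¹) 1 < ε / 3 := hV (hmem k)
  rw [h.div_one] at t1
  have t2 := (hν2 (N + k) (by omega)).trans_le (min_le_left _ _)
  have t3 := (hν2 N le_rfl).trans_le (min_le_left _ _)
  have t4 := h.triangle (w (N + k) * g⁻¹) (ν (N + k)) (w N * g⁻¹)
  have t5 := h.triangle (ν (N + k)) (ν N) (w N * g⁻¹)
  rw [h.mul_right, h.comm _ (ν (N + k))] at t4
  linarith

theorem tendsto_pi_iff {K : ℕ → Type*} [∀ m, Group (K m)] [∀ m, TopologicalSpace (K m)]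
    {d : ∀ m, K m → K m → ℝ} (hd : ∀ m, IsCompatDist (d m)) {H : Subgroup (∀ m, K m)}
    {ι : Type*} {u : ι → H} {l : Filter ι} {a : H} :
    Tendsto u l (𝓝 a) ↔
      ∀ m, ∀ ε > 0, ∀ᶠ i in l, d m ((u i : ∀ m, K m) m) ((a : ∀ m, K m) m) < ε := by
  rw [tendsto_subtype_rng, tendsto_pi_nhds]
  exact forall_congr' fun m => (hd m).tendsto_iff

/-- The evaluation of a subgroup of a product at a coordinate. -/
def coordHom {K : ℕ → Type*} [∀ m, Group (K m)] (H : Subgroup (∀ m, K m)) (m : ℕ) : H →* K m :=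
  (Pi.evalMonoidHom K m).comp H.subtype

/-- By invariance, inserting v between u and u'⁻¹ moves the product by exactly the distance from v
to 1 in each coordinate. -/
theorem tendsto_mul_mul_inv_iff {K : ℕ → Type*} [∀ m, Group (K m)] [∀ m, TopologicalSpace (K m)]
    {d : ∀ m, K m → K m → ℝ} (hd : ∀ m, IsCompatDist (d m)) {H : Subgroup (∀ m, K m)}
    {ι : Type*} {u u' v : ι → H} {l : Filter ι} {a : H}
    (hu : Tendsto (fun i => u i * (u' i)⁻¹) l (𝓝 a)) :
    Tendsto (fun i => u i * v i * (u' i)⁻¹) l (𝓝 a) ↔ Tendsto v l (𝓝 1) := by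
  rw [tendsto_pi_iff hd] at hu ⊢
  rw [tendsto_pi_iff hd]
  have key : ∀ m i, d m (coordHom H m (u i * v i * (u' i)⁻¹)) (coordHom H m (u i * (u' i)⁻¹)) =
      d m (coordHom H m (v i)) (coordHom H m 1) := by
    intro m i
    have h := ((hd m).toIsInvDist.comp (coordHom H m))
    rw [h.mul_right, ← h.mul_left (u i) (v i) 1, mul_one]
  change (∀ m, ∀ ε > 0, ∀ᶠ i in l, d m (coordHom H m (u i * (u' i)⁻¹)) (coordHom H m a) < ε) at hu
  change (∀ m, ∀ ε > 0, ∀ᶠ i in l, d m (coordHom H m (u i * v i * (u' i)⁻¹))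
    (coordHom H m a) < ε) ↔
    (∀ m, ∀ ε > 0, ∀ᶠ i in l, d m (coordHom H m (v i)) (coordHom H m 1) < ε)
  refine forall_congr' fun m => ⟨fun h ε hε => ?_, fun h ε hε => ?_⟩
  · filter_upwards [h (ε / 2) (by positivity), hu m (ε / 2) (by positivity)] with i h1 h2
    rw [← key]
    have := (hd m).triangle (coordHom H m (u i * v i * (u' i)⁻¹)) (coordHom H m a)
      (coordHom H m (u i * (u' i)⁻¹))
    rw [(hd m).comm (coordHom H m a)] at this
    linarith
  · filter_upwards [h (ε / 2) (by positivity), hu m (ε / 2) (by positivity)] with i h1 h2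
    rw [← key] at h1
    have := (hd m).triangle (coordHom H m (u i * v i * (u' i)⁻¹))
      (coordHom H m (u i * (u' i)⁻¹)) (coordHom H m a)
    linarith

theorem tendsto_even_odd {α : Type*} {u : ℕ → α} {l : Filter α} :
    Tendsto u atTop l ↔ Tendsto (fun n => u (2 * n)) atTop l ∧
      Tendsto (fun n => u (2 * n + 1)) atTop l := by
  constructor
  · intro h
    exact ⟨h.comp (tendsto_atTop_mono (fun n => by omega : ∀ n, n ≤ 2 * n) tendsto_id),
      h.comp (tendsto_atTop_mono (fun n => by omega : ∀ n, n ≤ 2 * n + 1) tendsto_id)⟩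
  · rintro ⟨h1, h2⟩ s hs
    obtain ⟨N, hN⟩ := eventually_atTop.1 ((h1.eventually hs).and (h2.eventually hs))
    change ∀ᶠ n in atTop, u n ∈ s
    filter_upwards [eventually_ge_atTop (2 * N + 1)] with n hn
    rcases Nat.even_or_odd' n with ⟨k, rfl | rfl⟩
    · exact (hN k (by omega)).1
    · exact (hN k (by omega)).2

/-- The even terms of the image carry S(x), and the odd ones multiply S(x) by a code of the
increments. Convergence of the quotients then says that S(x_n y_n⁻¹) converges and that x_n y_n⁻¹
has vanishing increments. -/
theorem borelReducible_of_closed_range {G : Type*} [Group G] [TopologicalSpace G]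
    [IsTopologicalGroup G] [PolishSpace G] (hG : IsTSI G) {K : ℕ → Type*} [∀ m, Group (K m)]
    [∀ m, TopologicalSpace (K m)] [∀ m, IsTopologicalGroup (K m)] [∀ m, PolishSpace (K m)]
    (hK : ∀ m, IsTSI (K m)) (H : Subgroup (∀ m, K m)) (hH : IsClosed (H : Set (∀ m, K m)))
    (S : G →* H) (hS : Continuous S) (hker : NonarchimedeanGroup S.ker)
    (hr : IsClosed (Set.range S)) (e : Set.Icc (0 : ℝ) 1 → H) (he : IsEmbedding e) :
    BorelReducible (inducedEquiv G) (inducedEquiv H) := by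
  have hP : PolishSpace H := hH.isClosedEmbedding_subtypeVal.polishSpace
  obtain ⟨δ, h⟩ := hG.exists_compatDist
  choose d hd using fun m => (hK m).exists_compatDist
  obtain ⟨γ, hγ⟩ := TopologicalSpace.exists_dense_seq G
  have hγ' : ∀ b, ∀ r > 0, ∃ i, δ b (γ i) < r := by
    intro b r hr0
    obtain ⟨i, hi⟩ := hγ.exists_mem_open (h.isOpen_ball b r) ⟨b, by simpa [h.self] using hr0⟩
    exact ⟨i, by rw [h.comm]; exact hi⟩
  let σ : ℕ ≃ ℕ × ℕ × ℕ := (Denumerable.eqv (ℕ × ℕ × ℕ)).symm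
  let t : (ℕ → G) → ℕ → Set.Icc (0 : ℝ) 1 := fun x p =>
    ⟨scaledCoord δ γ (σ p).2 ((x (σ p).1)⁻¹ * x ((σ p).1 + 1)), scaledCoord_mem _ _⟩
  let f : (ℕ → G) → ℕ → H := fun x p =>
    if p % 2 = 0 then S (x (p / 2)) else S (x (p / 2)) * e (t x (p / 2))
  have hf0 : ∀ x p, f x (2 * p) = S (x p) := fun x p => by simp [f]
  have hf1 : ∀ x p, f x (2 * p + 1) = S (x p) * e (t x p) := fun x p => by
    simp [f, Nat.add_mod, show (2 * p + 1) / 2 = p by omega]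
  have hfc : Continuous f := by
    have ht : ∀ p, Continuous fun x => t x p := fun p =>
      ((continuous_scaledCoord h _).comp (by fun_prop)).subtype_mk _
    refine continuous_pi fun p => ?_
    by_cases hp : p % 2 = 0
    · simp only [f, hp, if_true]
      fun_prop
    · simp only [f, hp, if_false]
      exact (hS.comp (continuous_apply _)).mul (he.continuous.comp (ht _))
  have hinc : ∀ (x y : ℕ → G) n, δ ((x n)⁻¹ * x (n + 1)) ((y n)⁻¹ * y (n + 1)) =
      δ (x (n + 1) * (y (n + 1))⁻¹) (x n * (y n)⁻¹) := by
    intro x y n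
    rw [← h.mul_left (x n), ← h.mul_right (y (n + 1))⁻¹]
    simp [mul_assoc]
  have hσ : ∀ s : Set (ℕ × ℕ × ℕ), s.Finite ↔ (σ ⁻¹' s).Finite := fun s =>
    ⟨fun hs => hs.preimage σ.injective.injOn, fun hs => hs.of_preimage σ.surjective⟩
  have hcode : ∀ x y : ℕ → G, Tendsto (fun p => e (t x p) * (e (t y p))⁻¹) atTop (𝓝 1) ↔
      ∀ ε > 0, ∀ᶠ n in atTop, δ (x (n + 1) * (y (n + 1))⁻¹) (x n * (y n)⁻¹) < ε := by
    intro x y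
    simp_rw [← hinc]
    rw [← finite_le_scaledCoord_sub_iff (b := fun n => (x n)⁻¹ * x (n + 1))
      (c := fun n => (y n)⁻¹ * y (n + 1)) h.toIsInvDist hγ', tendsto_mul_inv_iff_of_embedding he,
      Metric.tendsto_nhds, ← Nat.cofinite_eq_atTop]
    refine forall_congr' fun ε => forall_congr' fun hε => ?_
    rw [eventually_cofinite, hσ]
    have : {p | ¬dist |(t x p : ℝ) - t y p| 0 < ε} = σ ⁻¹' {q : ℕ × ℕ × ℕ |
        ε ≤ |scaledCoord δ γ q.2 ((x q.1)⁻¹ * x (q.1 + 1)) -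
          scaledCoord δ γ q.2 ((y q.1)⁻¹ * y (q.1 + 1))|} := by
      ext p
      simp [t]
    rw [this]
  refine ⟨f, ?_, fun x y => ?_⟩
  · let _ : MeasurableSpace (ℕ → G) := borel _
    let _ : MeasurableSpace (ℕ → H) := borel _
    have : BorelSpace (ℕ → G) := ⟨rfl⟩
    have : BorelSpace (ℕ → H) := ⟨rfl⟩
    exact hfc.measurable
  · rw [inducedEquiv_rel, inducedEquiv_rel]
    have hodd : ∀ p, f x (2 * p + 1) * (f y (2 * p + 1))⁻¹ =
        S (x p) * (e (t x p) * (e (t y p))⁻¹) * (S (y p))⁻¹ := by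
      intro p
      rw [hf1, hf1]
      group
    constructor
    · rintro ⟨g, hg⟩
      refine ⟨S g, tendsto_even_odd.2 ?_⟩
      have h1 : Tendsto (fun p => S (x p) * (S (y p))⁻¹) atTop (𝓝 (S g)) := by
        simpa [Function.comp_def] using (hS.tendsto g).comp hg
      simp_rw [hodd, hf0]
      refine ⟨h1, (tendsto_mul_mul_inv_iff hd h1).2 ((hcode x y).2 fun ε hε => ?_)⟩
      have h2 := h.tendsto_iff.1 hg (ε / 2) (by positivity)
      have h3 := h.tendsto_iff.1 ((tendsto_add_atTop_iff_nat 1).2 hg) (ε / 2) (by positivity)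
      filter_upwards [h2, h3] with n h2 h3
      have := h.triangle (x (n + 1) * (y (n + 1))⁻¹) g (x n * (y n)⁻¹)
      rw [h.comm g] at this
      linarith
    · rintro ⟨a, ha⟩
      obtain ⟨h1, h2⟩ := tendsto_even_odd.1 ha
      simp_rw [hodd] at h2
      simp_rw [hf0] at h1
      have h3 := (hcode x y).1 ((tendsto_mul_mul_inv_iff hd h1).1 h2)
      exact h.exists_tendsto_of_map S hS hker hr h3 (a := a) (by simpa using h1)

/-! ### Blocks and codings -/

/-- The number of the block containing `t`, where block `i` is `[s i, s (i + 1))`. -/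
def blk (s : ℕ → ℕ) (t : ℕ) : ℕ := Nat.findGreatest (fun i => s i ≤ t) t

theorem blk_eq {s : ℕ → ℕ} (hs : StrictMono s) {i t : ℕ} (h1 : s i ≤ t) (h2 : t < s (i + 1)) :
    blk s t = i := by
  rw [blk, Nat.findGreatest_eq_iff]
  refine ⟨hs.le_apply.trans h1, fun _ => h1, fun n hn _ hnt => ?_⟩
  have : s (i + 1) ≤ s n := hs.monotone hn
  omega

theorem blk_eq_zero {s : ℕ → ℕ} (hs : StrictMono s) {t : ℕ} (h : t < s 1) : blk s t = 0 := by
  rw [blk, Nat.findGreatest_eq_zero_iff]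
  intro n hn _
  have : s 1 ≤ s n := hs.monotone hn
  omega

theorem le_blk {s : ℕ → ℕ} (hs : StrictMono s) {i t : ℕ} (h : s i ≤ t) : i ≤ blk s t :=
  Nat.le_findGreatest (hs.le_apply.trans h) h

theorem blk_lt {s : ℕ → ℕ} (hs : StrictMono s) {i t : ℕ} (hi : 0 < i) (h : t < s i) :
    blk s t < i := by
  by_contra hc
  have h1 : s (blk s t) ≤ t :=
    Nat.findGreatest_of_ne_zero (P := fun i => s i ≤ t) (n := t) rfl (by omega)
  have : s i ≤ s (blk s t) := hs.monotone (not_lt.1 hc)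
  omega

/-- Block i is [s i, e (s i)] and will host the counterexample of index s i, whose changes start
after s i. The requirement K ≤ s 0 makes all error terms small. -/
theorem exists_blocks (e : ℕ → ℕ) (K : ℕ) (he : ∀ k ≥ K, k ≤ e k) :
    ∃ s : ℕ → ℕ, StrictMono s ∧ s 0 = K ∧ (∀ i, s (i + 1) = e (s i) + 1) ∧ ∀ i, K + i ≤ s i := by
  let s : ℕ → ℕ := fun i => Nat.rec K (fun _ k => e k + 1) i
  have hs : ∀ i, s (i + 1) = e (s i) + 1 := fun i => rfl
  have h1 : ∀ i, K + i ≤ s i := by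
    intro i
    induction i with
    | zero => exact le_rfl
    | succ i ih =>
      have := he (s i) (by omega)
      rw [hs]
      omega
  refine ⟨s, strictMono_nat_of_lt_succ fun i => ?_, rfl, hs, h1⟩
  have := he (s i) (by have := h1 i; omega)
  rw [hs]
  omega

/-- The pointwise quotient of two values of `Φ`. -/
def ratio {G H : Type*} [Group H] (Φ : (ℕ → G) → ℕ → H) (x y : ℕ → G) (n : ℕ) : H :=
  Φ x n * (Φ y n)⁻¹

theorem ratio_mul {G H : Type*} [Group H] {Φ : (ℕ → G) → ℕ → H} (x y w : ℕ → G) (n : ℕ) :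
    ratio Φ x y n * ratio Φ y w n = ratio Φ x w n := by
  simp [ratio]

theorem ratio_self {G H : Type*} [Group H] {Φ : (ℕ → G) → ℕ → H} (x : ℕ → G) (n : ℕ) :
    ratio Φ x x n = 1 := by
  simp [ratio]

/-- A map `Φ` on the sequences `x` with `x i ∈ F i` which behaves like a blockwise continuous
reduction: changing finitely many coordinates `< k`, or multiplying all coordinates `≥ k` by a
constant, has settled at time `N k`, and coordinates `> k` are not seen before time `N k`. -/
structure Coding {G H : Type*} [Group G] [TopologicalSpace G] [Group H] (δ : H → H → ℝ)
    (F : ℕ → Set G) (Φ : (ℕ → G) → ℕ → H) (N : ℕ → ℕ) (m : ℕ) : Prop where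
  dist : IsInvDist δ
  F_mono : Monotone F
  F_one : ∀ i, 1 ∈ F i
  N_mono : StrictMono N
  osc : ∀ k ≥ m, ∀ x y : ℕ → G, (∀ i, x i ∈ F i) → (∀ i, y i ∈ F i) →
    (∀ i ≥ k, x i * (y i)⁻¹ = x k * (y k)⁻¹) → ∀ n ≥ N k, ∀ n' ≥ N k,
      δ (ratio Φ x y n) (ratio Φ x y n') ≤ (1 / 2) ^ k
  near : ∀ k ≥ m, ∀ x y : ℕ → G, (∀ i, x i ∈ F i) → (∀ i, y i ∈ F i) →
    (∀ i ≤ k, x i = y i) → ∀ n ≤ N k, δ (Φ x n) (Φ y n) ≤ (1 / 2) ^ k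
  cauchy : ∀ x y : ℕ → G, (∀ i, x i ∈ F i) → (∀ i, y i ∈ F i) →
    Tendsto (fun i => x i * (y i)⁻¹) atTop (𝓝 1) → ∀ η > 0, ∃ n₀, ∀ n ≥ n₀,
      δ (ratio Φ x y n) (ratio Φ x y n₀) < η

theorem half_pow_anti {k e : ℕ} (h : k ≤ e) : (1 / 2 : ℝ) ^ e ≤ (1 / 2) ^ k :=
  pow_le_pow_of_le_one (by norm_num) (by norm_num) h

theorem exists_half_pow_le (m : ℕ) {η : ℝ} (hη : 0 < η) :
    ∃ K ≥ m, (1 / 2 : ℝ) ^ K ≤ η := by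
  obtain ⟨K, hK⟩ := exists_pow_lt_of_lt_one hη (by norm_num : (1 / 2 : ℝ) < 1)
  exact ⟨max m K, le_max_left _ _, (half_pow_anti (le_max_right _ _)).trans hK.le⟩

namespace Coding

variable {G H : Type*} [Group G] [TopologicalSpace G] [Group H] {δ : H → H → ℝ}
  {F : ℕ → Set G} {Φ : (ℕ → G) → ℕ → H} {N : ℕ → ℕ} {m : ℕ}

theorem dist_ratio_one (c : Coding δ F Φ N m) (x y : ℕ → G) (n : ℕ) :
    δ (ratio Φ x y n) 1 = δ (Φ x n) (Φ y n) := c.dist.div_one _ _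

theorem dist_ratio_comm (c : Coding δ F Φ N m) (x y : ℕ → G) (n : ℕ) :
    δ (ratio Φ x y n) 1 = δ (ratio Φ y x n) 1 := by
  rw [c.dist_ratio_one, c.dist_ratio_one, c.dist.comm]

theorem dist_ratio_triangle (c : Coding δ F Φ N m) (x y w : ℕ → G) (n : ℕ) :
    δ (ratio Φ x w n) 1 ≤ δ (ratio Φ x y n) 1 + δ (ratio Φ y w n) 1 := by
  rw [← ratio_mul x y w]
  exact c.dist.mul_one_le _ _

theorem ratio_near (c : Coding δ F Φ N m) {k : ℕ} (hk : m ≤ k) {x y x' y' : ℕ → G}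
    (hx : ∀ i, x i ∈ F i) (hy : ∀ i, y i ∈ F i) (hx' : ∀ i, x' i ∈ F i) (hy' : ∀ i, y' i ∈ F i)
    (h1 : ∀ i ≤ k, x i = x' i) (h2 : ∀ i ≤ k, y i = y' i) {n : ℕ} (hn : n ≤ N k) :
    δ (ratio Φ x y n) (ratio Φ x' y' n) ≤ 2 * (1 / 2) ^ k := by
  have := c.dist.div_div (Φ x n) (Φ y n) (Φ x' n) (Φ y' n)
  have t1 := c.near k hk x x' hx hx' h1 n hn
  have t2 := c.near k hk y y' hy hy' h2 n hn
  unfold ratio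
  linarith

theorem ratio_near_one (c : Coding δ F Φ N m) {k : ℕ} (hk : m ≤ k) {x y : ℕ → G}
    (hx : ∀ i, x i ∈ F i) (hy : ∀ i, y i ∈ F i)
    (h : ∀ i ≤ k, x i = y i) {n : ℕ} (hn : n ≤ N k) :
    δ (ratio Φ x y n) 1 ≤ (1 / 2) ^ k := by
  rw [c.dist_ratio_one]
  exact c.near k hk x y hx hy h n hn

/-- The variation of the quotient over a block depends, up to a small error, only on the
coordinates in that block. -/
theorem ratio_local (c : Coding δ F Φ N m) {k e : ℕ} (hk : m ≤ k) (hke : k ≤ e)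
    {x y x' y' : ℕ → G} (hx : ∀ i, x i ∈ F i) (hy : ∀ i, y i ∈ F i) (hx' : ∀ i, x' i ∈ F i)
    (hy' : ∀ i, y' i ∈ F i) (hxy : ∀ i ≤ k, x i = y i) (h1 : ∀ i, k ≤ i → i ≤ e → x' i = x i)
    (h2 : ∀ i, k ≤ i → i ≤ e → y' i = y i) {n : ℕ} (hn : N k ≤ n) (hne : n ≤ N e) :
    δ (ratio Φ x' y' (N k)) (ratio Φ x' y' n) ≤ δ (ratio Φ x y n) 1 + 7 * (1 / 2) ^ k ∧
      δ (ratio Φ x y n) 1 ≤ δ (ratio Φ x' y' (N k)) (ratio Φ x' y' n) + 7 * (1 / 2) ^ k := by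
  have hε := half_pow_anti hke
  -- The hybrids w, w' look like x', y' up to time N e, and differ from x, y only before k, so those
  -- two effects have settled from N k on. Hence the quotients of w, w' and of x, y vary alike. The
  -- constant 7 is 2 + 2 + 2 + 1: two uses of `ratio_near`, two of `osc`, one of `ratio_near_one`.
  let w : ℕ → G := fun i => if i < k then x' i else x i
  let w' : ℕ → G := fun i => if i < k then y' i else y i
  have hw : ∀ i, w i ∈ F i := fun i => by dsimp only [w]; split_ifs; exacts [hx' i, hx i]
  have hw' : ∀ i, w' i ∈ F i := fun i => by dsimp only [w']; split_ifs; exacts [hy' i, hy i]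
  have hwx : ∀ i ≥ k, w i = x i := fun i hi => if_neg (not_lt.2 hi)
  have hwy : ∀ i ≥ k, w' i = y i := fun i hi => if_neg (not_lt.2 hi)
  have hwx' : ∀ i ≤ e, w i = x' i := fun i hi => by
    dsimp only [w]; split_ifs with hik
    · rfl
    · exact (h1 i (not_lt.1 hik) hi).symm
  have hwy' : ∀ i ≤ e, w' i = y' i := fun i hi => by
    dsimp only [w']; split_ifs with hik
    · rfl
    · exact (h2 i (not_lt.1 hik) hi).symm
  have a1 := c.ratio_near (hk.trans hke) hw hw' hx' hy' hwx' hwy' hne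
  have a2 := c.ratio_near (hk.trans hke) hw hw' hx' hy' hwx' hwy' (c.N_mono.monotone hke)
  have b1 := c.osc k hk w x hw hx (fun i hi => by simp [hwx i hi, hwx k le_rfl]) n hn _ le_rfl
  have b2 := c.osc k hk y w' hy hw' (fun i hi => by simp [hwy i hi, hwy k le_rfl]) n hn _ le_rfl
  have d := c.ratio_near_one hk hx hy hxy le_rfl
  have e1 : ∀ n, ratio Φ w w' n = ratio Φ w x n * ratio Φ x y n * ratio Φ y w' n := by
    intro n
    rw [ratio_mul, ratio_mul]
  have f1 : δ (ratio Φ w w' n)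
      (ratio Φ w x (N k) * ratio Φ x y n * ratio Φ y w' (N k)) ≤ 2 * (1 / 2) ^ k := by
    rw [e1]
    have t1 := c.dist.mul_mul (ratio Φ w x n * ratio Φ x y n) (ratio Φ y w' n)
      (ratio Φ w x (N k) * ratio Φ x y n) (ratio Φ y w' (N k))
    rw [c.dist.mul_right] at t1
    linarith
  have f2 : δ (ratio Φ w x (N k) * ratio Φ x y n * ratio Φ y w' (N k)) (ratio Φ w w' (N k)) =
      δ (ratio Φ x y n) (ratio Φ x y (N k)) := by
    rw [e1, c.dist.mul_right, c.dist.mul_left]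
  have g1 := c.dist.triangle (ratio Φ x' y' (N k)) (ratio Φ w w' (N k)) (ratio Φ x' y' n)
  have g2 := c.dist.triangle (ratio Φ w w' (N k)) (ratio Φ w w' n) (ratio Φ x' y' n)
  have g3 := c.dist.triangle (ratio Φ w w' n)
    (ratio Φ w x (N k) * ratio Φ x y n * ratio Φ y w' (N k)) (ratio Φ w w' (N k))
  have g4 := c.dist.triangle (ratio Φ x y n) 1 (ratio Φ x y (N k))
  have g5 := c.dist.triangle (ratio Φ x y n) (ratio Φ x y (N k)) 1
  have g6 := c.dist.triangle (ratio Φ w x (N k) * ratio Φ x y n * ratio Φ y w' (N k))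
    (ratio Φ w w' n) (ratio Φ w w' (N k))
  have g7 := c.dist.triangle (ratio Φ w w' n) (ratio Φ x' y' n) (ratio Φ w w' (N k))
  have g8 := c.dist.triangle (ratio Φ x' y' n) (ratio Φ x' y' (N k)) (ratio Φ w w' (N k))
  rw [c.dist.comm (ratio Φ x' y' (N k)) (ratio Φ w w' (N k))] at g1 g8
  rw [c.dist.comm (ratio Φ w w' (N k)) (ratio Φ w w' n)] at g2
  rw [c.dist.comm 1] at g4
  rw [c.dist.comm _ (ratio Φ w w' n)] at g6
  rw [c.dist.comm (ratio Φ x' y' n) (ratio Φ x' y' (N k))] at g8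
  rw [f2] at g3 g6
  constructor <;> linarith

/-- Small changes of the coordinates have small effects. -/
theorem exists_forall_small (c : Coding δ F Φ N m) {d : G → G → ℝ} (hd : IsCompatDist d)
    {η : ℝ} (hη : 0 < η) : ∃ ρ > 0, ∃ j ≥ m, ∀ x y : ℕ → G, (∀ i, x i ∈ F i) → (∀ i, y i ∈ F i) →
      (∀ i ≤ j, x i = y i) → (∀ i, d (x i) (y i) < ρ) → ∀ n, δ (ratio Φ x y n) 1 ≤ η := by
  by_contra! hcon
  have hcon' : ∀ k : ℕ, ∃ (x y : ℕ → G) (n : ℕ), m ≤ k → (∀ i, x i ∈ F i) ∧ (∀ i, y i ∈ F i) ∧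
      (∀ i ≤ k, x i = y i) ∧ (∀ i, d (x i) (y i) < (1 / 2) ^ k) ∧ η < δ (ratio Φ x y n) 1 := by
    intro k
    by_cases hk : m ≤ k
    · obtain ⟨x, y, h1, h2, h3, h4, n, h5⟩ := hcon ((1 / 2) ^ k) (by positivity) k hk
      exact ⟨x, y, n, fun _ => ⟨h1, h2, h3, h4, h5⟩⟩
    · exact ⟨1, 1, 0, fun h => absurd h hk⟩
  choose x y n h using hcon'
  obtain ⟨K, hKm, hK⟩ := exists_half_pow_le m (show 0 < η / 16 by positivity)
  -- A block reaching n k suffices, since n k ≤ N (n k). The concatenated quotient X Y⁻¹ tends to 1,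
  -- so its Φ-quotient is Cauchy, against a variation of about η in every block.
  obtain ⟨s, hs, hs0, hs1, hsK⟩ := exists_blocks (fun k => max k (n k)) K fun k _ => le_max_left _ _
  have hsm : ∀ i, m ≤ s i := fun i => hKm.trans (by have := hsK i; omega)
  let X : ℕ → G := fun t => x (s (blk s t)) t
  let Y : ℕ → G := fun t => y (s (blk s t)) t
  have hX : ∀ t, X t ∈ F t := fun t => (h _ (hsm _)).1 t
  have hY : ∀ t, Y t ∈ F t := fun t => (h _ (hsm _)).2.1 t
  obtain ⟨n₀, hn₀⟩ := c.cauchy X Y hX hY (by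
    rw [hd.tendsto_iff]
    intro ε hε
    obtain ⟨i, -, hi⟩ := exists_half_pow_le 0 hε
    filter_upwards [eventually_ge_atTop (s i)] with t ht
    rw [hd.div_one]
    refine ((h _ (hsm (blk s t))).2.2.2.1 t).trans_le ((half_pow_anti ?_).trans hi)
    exact (le_blk hs ht).trans hs.le_apply) (η / 8) (by positivity)
  let k := s n₀
  obtain ⟨h1, h2, h3, -, h5⟩ := h k (hsm _)
  have hkε : (1 / 2 : ℝ) ^ k ≤ η / 16 := (half_pow_anti (by have := hsK n₀; omega)).trans hK
  have hnk : N k ≤ n k := by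
    by_contra hlt
    have := c.ratio_near_one (hsm _) h1 h2 h3 (not_le.1 hlt).le
    linarith
  have hblk : ∀ t, k ≤ t → t ≤ max k (n k) → blk s t = n₀ := fun t h1 h2 =>
    blk_eq hs h1 (by rw [hs1]; exact Nat.lt_succ_of_le h2)
  have hloc := (c.ratio_local (hsm n₀) (le_max_left k (n k)) h1 h2 hX hY h3
    (fun t ht1 ht2 => by simp only [X, hblk t ht1 ht2]; rfl)
    (fun t ht1 ht2 => by simp only [Y, hblk t ht1 ht2]; rfl) hnk
    ((le_max_right _ _).trans c.N_mono.le_apply)).2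
  have hNk : n₀ ≤ N k := hs.le_apply.trans c.N_mono.le_apply
  have t1 := hn₀ (N k) hNk
  have t2 := hn₀ (n k) (hNk.trans hnk)
  have t3 := c.dist.triangle (ratio Φ X Y (N k)) (ratio Φ X Y n₀) (ratio Φ X Y (n k))
  rw [c.dist.comm (ratio Φ X Y n₀)] at t3
  change _ ≤ _ + 7 * (1 / 2) ^ k at hloc
  change δ (ratio Φ (x k) (y k) (n k)) 1 ≤ δ (ratio Φ X Y (N k)) (ratio Φ X Y (n k)) + _ at hloc
  linarith

end Coding

/-! ### Strong NSS and negligible exchanges -/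

/-- A sequence that does not converge to the identity has products of finite subsequences at a
fixed distance from the identity. -/
def NoSmallProducts {H : Type*} [Group H] (δ : H → H → ℝ) : Prop :=
  ∃ v > 0, ∀ h : ℕ → H, ¬ Tendsto (fun n => δ (h n) 1) atTop (𝓝 0) →
    ∃ l : List ℕ, l.Pairwise (· < ·) ∧ v ≤ δ (l.map h).prod 1

/-- A ball inside the unenclosed set replaces it; pulling back along f transfers the property to the
pseudo-distance of one coordinate. -/
theorem IsStronglyNSS.noSmallProducts {K : Type*} [Group K] [TopologicalSpace K]
    (hK : IsStronglyNSS K) {d : K → K → ℝ} (hd : IsCompatDist d) {H : Type*} [Group H]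
    (f : H →* K) : NoSmallProducts fun a b => d (f a) (f b) := by
  obtain ⟨V, hV, hV1, h⟩ := hK
  obtain ⟨v, hv, hvV⟩ := (hd.mem_nhds 1 V).1 (hV.mem_nhds hV1)
  refine ⟨v, hv, fun u hu => ?_⟩
  obtain ⟨k, n, hn, hnV⟩ := h (fun i => f (u i)) (by
    intro hc
    apply hu
    rw [Metric.tendsto_nhds]
    intro ε hε
    filter_upwards [hd.tendsto_iff.1 hc ε hε] with i hi
    simpa [abs_of_nonneg (hd.nonneg _ _)] using hi)
  refine ⟨List.ofFn n, ?_, ?_⟩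
  · rw [List.pairwise_ofFn]
    exact fun i j hij => hn hij
  · by_contra hc
    apply hnV
    apply hvV
    rw [not_le] at hc
    change d (f _) (f 1) < v at hc
    rw [map_one, map_list_prod, List.map_map, List.map_ofFn] at hc
    exact hc

namespace Coding

variable {G H : Type*} [Group G] [TopologicalSpace G] [Group H] {δ : H → H → ℝ}
  {F : ℕ → Set G} {Φ : (ℕ → G) → ℕ → H} {N : ℕ → ℕ} {m : ℕ}

/-- Changes of finitely many coordinates by elements of a fixed neighbourhood of the identity
have an effect which tends to zero as the first changed coordinate tends to infinity. -/
theorem exists_forall_vanishing (c : Coding δ F Φ N m) (hδ : NoSmallProducts δ) {d : G → G → ℝ}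
    (hd : IsCompatDist d) : ∃ ρ > 0, ∀ η > 0, ∃ j ≥ m, ∀ (x y : ℕ → G) (e : ℕ),
      (∀ i, x i ∈ F i) → (∀ i, y i ∈ F i) → (∀ i ≤ j, x i = y i) → (∀ i ≥ e, x i = y i) →
      (∀ i, d (x i) (y i) < ρ) → ∀ n ≥ N e, δ (ratio Φ x y n) 1 ≤ η := by
  classical
  obtain ⟨v, hv, hvl⟩ := hδ
  -- With this ρ any number of simultaneous changes has effect at most v/2, whereas a product of
  -- single effects will have size at least v.
  obtain ⟨ρ, hρ, j, hjm, hj⟩ := c.exists_forall_small hd (half_pos hv)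
  refine ⟨ρ, hρ, fun η hη => ?_⟩
  by_contra! hcon
  have hcon' : ∀ k : ℕ, ∃ (x y : ℕ → G) (e n : ℕ), m ≤ k → (∀ i, x i ∈ F i) ∧ (∀ i, y i ∈ F i) ∧
      (∀ i ≤ k, x i = y i) ∧ (∀ i ≥ e, x i = y i) ∧ (∀ i, d (x i) (y i) < ρ) ∧ N e ≤ n ∧
        η < δ (ratio Φ x y n) 1 := by
    intro k
    by_cases hk : m ≤ k
    · obtain ⟨x, y, e, h1, h2, h3, h4, h5, n, h6, h7⟩ := hcon k hk
      exact ⟨x, y, e, n, fun _ => ⟨h1, h2, h3, h4, h5, h6, h7⟩⟩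
    · exact ⟨1, 1, 0, 0, fun h => absurd h hk⟩
  choose x y e n h using hcon'
  have hke : ∀ k, m ≤ k → k ≤ e k := by
    intro k hk
    obtain ⟨-, -, h3, h4, -, -, h7⟩ := h k hk
    by_contra hlt
    have : x k = y k := funext fun i => by
      rcases le_total i k with hi | hi
      · exact h3 i hi
      · exact h4 i (by omega)
    rw [this, ratio_self, c.dist.self] at h7
    linarith
  obtain ⟨K, hKm, hK⟩ := exists_half_pow_le (max m j)
    (show 0 < min (η / 20) (v / 24) by positivity)
  obtain ⟨s, hs, hs0, hs1, hsK⟩ := exists_blocks e K fun k hk => hke k (by omega)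
  have hsm : ∀ i, m ≤ s i := fun i => by have := hsK i; omega
  have hes : ∀ i, s i ≤ e (s i) := fun i => hke _ (hsm i)
  let X : ℕ → G := fun t => x (s (blk s t)) t
  let Y : ℕ → G := fun t => y (s (blk s t)) t
  have hY : ∀ t, Y t ∈ F t := fun t => (h _ (hsm _)).2.1 t
  -- The changes are switched on exactly in the blocks listed in l.
  let v' : List ℕ → ℕ → G := fun l t => if blk s t ∈ l then X t else Y t
  have hv' : ∀ l t, v' l t ∈ F t := fun l t => by
    dsimp only [v']
    split_ifs
    exacts [(h _ (hsm _)).1 t, hY t]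
  have hblk : ∀ i t, s i ≤ t → t ≤ e (s i) → blk s t = i := fun i t h1 h2 =>
    blk_eq hs h1 (by rw [hs1]; exact Nat.lt_succ_of_le h2)
  have hXY : ∀ i, X (e (s i)) = Y (e (s i)) := fun i => by
    simp only [X, Y, hblk i _ (hes i) le_rfl]
    exact (h _ (hsm i)).2.2.2.1 _ le_rfl
  have hYnil : v' [] = Y := funext fun t => by simp [v']
  let u : ℕ → H := fun i => ratio Φ (v' [i]) Y (N (e (s i)))
  -- the single changes do not tend to the identity
  have hu : ∀ i, η / 2 ≤ δ (u i) 1 := by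
    intro i
    obtain ⟨h1, h2, h3, h4, h5, h6, h7⟩ := h (s i) (hsm i)
    have hε : (1 / 2 : ℝ) ^ s i ≤ η / 20 :=
      (half_pow_anti (by have := hsK i; omega)).trans (hK.trans (min_le_left _ _))
    have hε' := half_pow_anti (hes i)
    have t1 := c.osc _ ((hsm i).trans (hes i)) _ _ h1 h2
      (fun t ht => by simp [h4 t ht, h4 _ le_rfl]) _ h6 _ le_rfl
    have t2 := (c.ratio_local (hsm i) (hes i) h1 h2 (hv' [i]) hY h3
      (fun t ht1 ht2 => by simp [v', X, hblk i t ht1 ht2])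
      (fun t ht1 ht2 => by simp [Y, hblk i t ht1 ht2]) (c.N_mono.monotone (hes i)) le_rfl).2
    have t3 := c.ratio_near_one (hsm i) (hv' [i]) hY (fun t ht => by
      dsimp only [v']
      split_ifs with hm
      · simp only [List.mem_singleton] at hm
        simp only [X, Y, hm]
        exact h3 t ht
      · rfl) (le_refl (N (s i)))
    have t4 := c.dist.triangle (ratio Φ (x (s i)) (y (s i)) (n (s i)))
      (ratio Φ (x (s i)) (y (s i)) (N (e (s i)))) 1
    have t5 := c.dist.triangle (ratio Φ (v' [i]) Y (N (s i))) 1 (ratio Φ (v' [i]) Y (N (e (s i))))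
    rw [c.dist.comm 1] at t5
    change η / 2 ≤ δ (ratio Φ (v' [i]) Y (N (e (s i)))) 1
    linarith
  obtain ⟨l, hl, hlv⟩ := hvl u (by
    intro hc
    obtain ⟨i, hi⟩ := (hc.eventually_lt_const (half_pos hη)).exists
    have := hu i
    linarith)
  -- finitely many changes multiply
  have hprod : ∀ (l : List ℕ), l.Pairwise (· < ·) → ∀ a, (∀ i ∈ l, a ≤ i) →
      ∀ n, (∀ i ∈ l, N (e (s i)) ≤ n) →
        δ (l.map u).prod (ratio Φ (v' l) Y n) ≤ 6 * (1 / 2) ^ (K + a) := by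
    intro l
    induction l with
    | nil =>
      intro _ a _ n _
      rw [hYnil, ratio_self, List.map_nil, List.prod_nil, c.dist.self]
      positivity
    | cons i l ih =>
      intro hl a ha n hn
      rw [List.pairwise_cons] at hl
      have t1 := ih hl.2 (i + 1) (fun j hj => hl.1 j hj) n (fun j hj => hn j (by simp [hj]))
      rw [List.map_cons, List.prod_cons, ← ratio_mul (v' (i :: l)) (v' l) Y]
      have t2 := c.dist.mul_mul (u i) (l.map u).prod (ratio Φ (v' (i :: l)) (v' l) n)
        (ratio Φ (v' l) Y n)
      have hbl : ∀ t ≤ e (s i), blk s t ≤ i := fun t ht =>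
        Nat.lt_succ_iff.1 (blk_lt hs i.succ_pos (by rw [hs1]; exact Nat.lt_succ_of_le ht))
      have hme : m ≤ e (s i) := (hsm i).trans (hes i)
      have t3 := c.ratio_near hme (hv' [i]) hY (hv' (i :: l)) (hv' l)
        (fun t ht => by
          dsimp only [v']
          have h1 := hbl t ht
          have : blk s t ∉ l := fun hc => by have := hl.1 _ hc; omega
          simp [this])
        (fun t ht => by
          dsimp only [v']
          have h1 := hbl t ht
          have : blk s t ∉ l := fun hc => by have := hl.1 _ hc; omega
          simp [this]) (le_refl (N (e (s i))))
      have hlast : ∀ t ≥ e (s i), v' (i :: l) t = v' l t := fun t ht => by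
        dsimp only [v']
        by_cases hti : blk s t = i
        · have : X t = Y t := by
            simp only [X, Y, hti]
            exact (h _ (hsm i)).2.2.2.1 _ ht
          simp [this]
        · simp [hti]
      have t4 := c.osc _ hme _ _ (hv' (i :: l)) (hv' l)
        (fun t ht => by rw [hlast t ht, hlast _ le_rfl]; simp) (N (e (s i))) le_rfl n
        (hn i (by simp))
      have t5 := c.dist.triangle (u i) (ratio Φ (v' (i :: l)) (v' l) (N (e (s i))))
        (ratio Φ (v' (i :: l)) (v' l) n)
      have e1 : (1 / 2 : ℝ) ^ e (s i) ≤ (1 / 2) ^ (K + i) :=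
        half_pow_anti ((hsK i).trans (hes i))
      have e2 : (1 / 2 : ℝ) ^ (K + (i + 1)) = (1 / 2) ^ (K + i) / 2 := by
        rw [← add_assoc, pow_succ]
        ring
      have e3 : (1 / 2 : ℝ) ^ (K + i) ≤ (1 / 2) ^ (K + a) :=
        half_pow_anti (by have := ha i (by simp); omega)
      rw [e2] at t1
      change δ (u i) _ ≤ _ at t3
      linarith
  obtain ⟨n₁, hn₁⟩ : ∃ n₁, ∀ i ∈ l, N (e (s i)) ≤ n₁ := by
    obtain ⟨n₁, hn₁⟩ := (l.map fun i => N (e (s i))).toFinset.exists_le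
    exact ⟨n₁, fun i hi => hn₁ _ (by
      simp only [List.mem_toFinset, List.mem_map]; exact ⟨i, hi, rfl⟩)⟩
  have t1 := hprod l hl 0 (fun _ _ => Nat.zero_le _) n₁ hn₁
  have t2 := hj (v' l) Y (hv' l) hY
    (fun t ht => by
      dsimp only [v']
      split_ifs
      · have hb : blk s t = 0 := blk_eq_zero hs (by
          have := hs (Nat.zero_lt_one)
          omega)
        simp only [X, Y, hb]
        exact (h _ (hsm 0)).2.2.1 t (by omega)
      · rfl)
    (fun t => by
      dsimp only [v']
      split_ifs
      · exact (h _ (hsm _)).2.2.2.2.1 t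
      · rwa [hd.self]) n₁
  have t3 := c.dist.triangle (l.map u).prod (ratio Φ (v' l) Y n₁) 1
  have t4 := hK.trans (min_le_right _ _)
  rw [add_zero] at t1
  linarith

/-- Changing coordinates from `b` to `a` has an effect which tends to zero as the first changed
coordinate tends to infinity. -/
def Negligible (δ : H → H → ℝ) (F : ℕ → Set G) (Φ : (ℕ → G) → ℕ → H) (N : ℕ → ℕ) (m : ℕ)
    (T : Set (G × G)) : Prop :=
  ∀ η > 0, ∃ j ≥ m, ∀ (x y : ℕ → G) (e : ℕ), (∀ i, x i ∈ F i) → (∀ i, y i ∈ F i) →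
    (∀ i ≤ j, x i = y i) → (∀ i ≥ e, x i = y i) → (∀ i, x i = y i ∨ (x i, y i) ∈ T) →
      ∀ n ≥ N e, δ (ratio Φ x y n) 1 ≤ η

theorem negligible_empty (c : Coding δ F Φ N m) : Negligible δ F Φ N m ∅ := fun η hη =>
  ⟨m, le_rfl, fun x y e _ _ _ _ h3 n _ => by
    have : x = y := funext fun i => (h3 i).resolve_right (Set.notMem_empty _)
    rw [this, ratio_self, c.dist.self]
    exact hη.le⟩

theorem Negligible.diag {a : G} (c : Coding δ F Φ N m) : Negligible δ F Φ N m {(a, a)} :=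
  fun η hη => by
    obtain ⟨j, hjm, hj⟩ := c.negligible_empty η hη
    refine ⟨j, hjm, fun x y e hx hy h1 h2 h3 => hj x y e hx hy h1 h2 fun i => Or.inl ?_⟩
    rcases h3 i with h | h
    · exact h
    · rw [Set.mem_singleton_iff, Prod.mk.injEq] at h
      rw [h.1, h.2]

theorem Negligible.symm {a b : G} (c : Coding δ F Φ N m) (h : Negligible δ F Φ N m {(a, b)}) :
    Negligible δ F Φ N m {(b, a)} := fun η hη => by
  obtain ⟨j, hjm, hj⟩ := h η hη
  refine ⟨j, hjm, fun x y e hx hy h1 h2 h3 n hn => ?_⟩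
  rw [c.dist_ratio_comm]
  refine hj y x e hy hx (fun i hi => (h1 i hi).symm) (fun i hi => (h2 i hi).symm)
    (fun i => ?_) n hn
  rcases h3 i with h | h
  · exact Or.inl h.symm
  · rw [Set.mem_singleton_iff, Prod.mk.injEq] at h
    exact Or.inr (by simp [h.1, h.2])

/-- Pass through the sequence with b at the changed places. It is admissible once the first change
comes after the index at which b enters F. -/
theorem Negligible.trans {a b a' : G} (c : Coding δ F Φ N m) (hb : ∃ i, b ∈ F i)
    (h : Negligible δ F Φ N m {(a, b)}) (h' : Negligible δ F Φ N m {(b, a')}) :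
    Negligible δ F Φ N m {(a, a')} := fun η hη => by
  classical
  obtain ⟨j, hjm, hj⟩ := h (η / 2) (half_pos hη)
  obtain ⟨j', -, hj'⟩ := h' (η / 2) (half_pos hη)
  obtain ⟨i₀, hi₀⟩ := hb
  refine ⟨max j (max j' i₀), hjm.trans (le_max_left _ _), fun x y e hx hy h1 h2 h3 n hn => ?_⟩
  let w : ℕ → G := fun i => if x i = y i then x i else b
  have hw : ∀ i, w i ∈ F i := fun i => by
    dsimp only [w]
    split_ifs with hxy
    · exact hx i
    · refine c.F_mono (by_contra fun hi => hxy (h1 i ?_)) hi₀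
      rw [not_le] at hi
      exact hi.le.trans ((le_max_right _ _).trans (le_max_right _ _))
  have hwx : ∀ i, x i = y i → x i = w i := fun i hi => (if_pos hi).symm
  have hwy : ∀ i, x i = y i → w i = y i := fun i hi => (if_pos hi).trans hi
  have t1 := hj x w e hx hw (fun i hi => hwx i (h1 i (hi.trans (le_max_left _ _))))
    (fun i hi => hwx i (h2 i hi)) (fun i => by
      by_cases hxy : x i = y i
      · exact Or.inl (hwx i hxy)
      · have := (h3 i).resolve_left hxy
        rw [Set.mem_singleton_iff, Prod.mk.injEq] at this
        exact Or.inr (by simp only [w, if_neg hxy, this.1]; rfl)) n hn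
  have t2 := hj' w y e hw hy
    (fun i hi => hwy i (h1 i (hi.trans ((le_max_left _ _).trans (le_max_right _ _)))))
    (fun i hi => hwy i (h2 i hi)) (fun i => by
      by_cases hxy : x i = y i
      · exact Or.inl (hwy i hxy)
      · have := (h3 i).resolve_left hxy
        rw [Set.mem_singleton_iff, Prod.mk.injEq] at this
        exact Or.inr (by simp only [w, if_neg hxy, this.2]; rfl)) n hn
  have t3 := c.dist_ratio_triangle x w y n
  linarith

/-- First make all changes of type (a, b), then the remaining ones. -/
theorem Negligible.insert {a b : G} {T : Set (G × G)} (c : Coding δ F Φ N m)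
    (h : Negligible δ F Φ N m {(a, b)}) (h' : Negligible δ F Φ N m T) :
    Negligible δ F Φ N m (insert (a, b) T) := fun η hη => by
  classical
  obtain ⟨j, hjm, hj⟩ := h (η / 2) (half_pos hη)
  obtain ⟨j', -, hj'⟩ := h' (η / 2) (half_pos hη)
  refine ⟨max j j', hjm.trans (le_max_left _ _), fun x y e hx hy h1 h2 h3 n hn => ?_⟩
  let w : ℕ → G := fun i => if x i = a ∧ y i = b then b else x i
  have hwc : ∀ i, (x i = a ∧ y i = b ∧ w i = y i) ∨ (w i = x i ∧ (x i = y i ∨ (x i, y i) ∈ T)) := by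
    intro i
    by_cases hab : x i = a ∧ y i = b
    · exact Or.inl ⟨hab.1, hab.2, by simp [w, hab]⟩
    · refine Or.inr ⟨by simp only [w]; rw [if_neg hab], (h3 i).imp_right fun hi => ?_⟩
      rcases hi with hi | hi
      · rw [Prod.mk.injEq] at hi
        exact absurd hi hab
      · exact hi
  have hw : ∀ i, w i ∈ F i := fun i => by
    rcases hwc i with ⟨-, -, h⟩ | ⟨h, -⟩ <;> rw [h]
    exacts [hy i, hx i]
  have hwxy : ∀ i, x i = y i → x i = w i ∧ w i = y i := fun i hi => by
    rcases hwc i with ⟨-, -, h⟩ | ⟨h, -⟩ <;> simp [h, hi]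
  have t1 := hj x w e hx hw (fun i hi => (hwxy i (h1 i (hi.trans (le_max_left _ _)))).1)
    (fun i hi => (hwxy i (h2 i hi)).1) (fun i => by
      rcases hwc i with ⟨h4, h5, h6⟩ | ⟨h, -⟩
      · exact Or.inr (by simp [h4, h6, h5])
      · exact Or.inl h.symm) n hn
  have t2 := hj' w y e hw hy (fun i hi => (hwxy i (h1 i (hi.trans (le_max_right _ _)))).2)
    (fun i hi => (hwxy i (h2 i hi)).2) (fun i => by
      rcases hwc i with ⟨h4, h5, h6⟩ | ⟨h, h4⟩
      · exact Or.inl h6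
      · rwa [h]) n hn
  have t3 := c.dist_ratio_triangle x w y n
  linarith

theorem negligible_of_finite (c : Coding δ F Φ N m) {T : Set (G × G)} (hT : T.Finite)
    (h : ∀ p ∈ T, Negligible δ F Φ N m {p}) : Negligible δ F Φ N m T := by
  induction T, hT using Set.Finite.induction_on with
  | empty => exact c.negligible_empty
  | @insert p T _ _ ih =>
    exact Negligible.insert c (h p (Set.mem_insert _ _))
      (ih fun q hq => h q (Set.mem_insert_of_mem _ hq))

/-- There is an open subgroup any two elements of which can be exchanged at a vanishing cost. -/
theorem exists_open_subgroup (c : Coding δ F Φ N m) (hδ : NoSmallProducts δ) {d : G → G → ℝ}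
    (hd : IsCompatDist d) {Γ : Subgroup G} (hΓ : Dense (Γ : Set G))
    (hΓF : ∀ g ∈ Γ, ∃ i, g ∈ F i) [IsTopologicalGroup G] :
    ∃ V : Subgroup G, IsOpen (V : Set G) ∧
      ∀ a ∈ Γ, ∀ b ∈ Γ, a * b⁻¹ ∈ V → Negligible δ F Φ N m {(a, b)} := by
  obtain ⟨ρ, hρ, h⟩ := c.exists_forall_vanishing hδ hd
  let U : Set G := {g | d g 1 < ρ}
  have hU : IsOpen U := hd.isOpen_ball 1 ρ
  have hU1 : (1 : G) ∈ U := by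
    change d 1 1 < ρ
    rwa [hd.self]
  -- Generating inside Γ keeps all intermediate elements in some F i, as transitivity requires;
  -- density of Γ makes the closure of Λ open.
  let Λ : Subgroup G := Subgroup.closure (U ∩ Γ)
  have hΛΓ : Λ ≤ Γ := (Subgroup.closure_le _).2 Set.inter_subset_right
  have hsmall : ∀ a b, d a b < ρ → Negligible δ F Φ N m {(a, b)} := by
    intro a b hab η hη
    obtain ⟨j, hjm, hj⟩ := h η hη
    refine ⟨j, hjm, fun x y e hx hy h1 h2 h3 => hj x y e hx hy h1 h2 fun i => ?_⟩
    rcases h3 i with h | h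
    · rw [h, hd.self]
      exact hρ
    · rw [Set.mem_singleton_iff, Prod.mk.injEq] at h
      rwa [h.1, h.2]
  have hΛ : ∀ g ∈ Λ, ∀ b ∈ Γ, Negligible δ F Φ N m {(g * b, b)} := by
    intro g hg
    induction hg using Subgroup.closure_induction with
    | mem g hg =>
      intro b _
      apply hsmall
      have := hd.mul_right b g 1
      rw [one_mul] at this
      rw [this]
      exact hg.1
    | one =>
      intro b _
      rw [one_mul]
      exact Negligible.diag c
    | mul g k hg hk ihg ihk =>
      intro b hb
      have hkb := Γ.mul_mem (hΛΓ hk) hb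
      rw [mul_assoc]
      exact (ihg _ hkb).trans c (hΓF _ hkb) (ihk b hb)
    | inv g hg ih =>
      intro b hb
      have := (ih (g⁻¹ * b) (Γ.mul_mem (Γ.inv_mem (hΛΓ hg)) hb)).symm c
      rwa [mul_inv_cancel_left] at this
  have hcl : ∀ g : G, ∀ ε > 0, ∃ a ∈ Γ, d a g < ε := by
    intro g ε hε
    obtain ⟨a, ha, ha'⟩ := hΓ.exists_mem_open (hd.isOpen_ball g ε) ⟨g, by
      change d g g < ε
      rwa [hd.self]⟩
    exact ⟨a, ha, ha'⟩
  refine ⟨Λ.topologicalClosure, ?_, fun a ha b hb hab => ?_⟩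
  · apply Subgroup.isOpen_of_mem_nhds _ (g := 1)
    refine Filter.mem_of_superset (hU.mem_nhds hU1) fun g hg => ?_
    change g ∈ closure (Λ : Set G)
    rw [mem_closure_iff_nhds]
    intro t ht
    obtain ⟨a, ⟨ha1, ha2⟩, ha3⟩ :=
      mem_closure_iff_nhds.1 (hΓ g) (t ∩ U) (inter_mem ht (hU.mem_nhds hg))
    exact ⟨a, ha1, Subgroup.subset_closure ⟨ha2, ha3⟩⟩
  · change a * b⁻¹ ∈ closure (Λ : Set G) at hab
    rw [mem_closure_iff_nhds] at hab
    obtain ⟨g, hg, hgΛ⟩ := hab _ (hd.ball_mem (a * b⁻¹) hρ)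
    change d g (a * b⁻¹) < ρ at hg
    -- With g in Λ close to a * b⁻¹, exchange a for the nearby g * b, and then g * b for b.
    have h1 : Negligible δ F Φ N m {(a, g * b)} := hsmall _ _ (by
      rw [← hd.mul_right b, inv_mul_cancel_right, hd.comm] at hg
      exact hg)
    exact h1.trans c (hΓF _ (Γ.mul_mem (hΛΓ hgΛ) hb)) (hΛ g hgΛ b hb)

end Coding

theorem exists_mem_block {M : ℕ → ℕ} (hM : StrictMono M) {i n : ℕ} (h : M i ≤ n) :
    ∃ l ≥ i, M l ≤ n ∧ n < M (l + 1) := by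
  refine ⟨blk M n, le_blk hM h, ?_, ?_⟩
  · exact Nat.findGreatest_spec (P := fun i => M i ≤ n) (hM.le_apply.trans h) h
  · by_contra hc
    have := le_blk hM (not_lt.1 hc)
    omega

/-! ### Asymptotic multiplicativity of step values -/

/-- The sequence equal to `1` before `j` and to `g` from `j` on. -/
def stepFn {G : Type*} [One G] (j : ℕ) (g : G) (i : ℕ) : G := if i < j then 1 else g

theorem stepFn_lt {G : Type*} [One G] {j i : ℕ} (g : G) (h : i < j) : stepFn j g i = 1 := if_pos h

theorem stepFn_ge {G : Type*} [One G] {j i : ℕ} (g : G) (h : j ≤ i) : stepFn j g i = g :=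
  if_neg (not_lt.2 h)

/-- The effect, at time `N j`, of multiplying all coordinates from `j` on by `g`. -/
def stepValue {G H : Type*} [One G] [Group H] (Φ : (ℕ → G) → ℕ → H) (N : ℕ → ℕ) (j : ℕ) (g : G) :
    H :=
  ratio Φ (stepFn j g) 1 (N j)

namespace Coding

variable {G H : Type*} [Group G] [TopologicalSpace G] [Group H] {δ : H → H → ℝ}
  {F : ℕ → Set G} {Φ : (ℕ → G) → ℕ → H} {N : ℕ → ℕ} {m : ℕ}

theorem stepFn_mem (c : Coding δ F Φ N m) {j : ℕ} {g : G} (hg : g ∈ F j) (i : ℕ) :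
    stepFn j g i ∈ F i := by
  rcases lt_or_ge i j with h | h
  · rw [stepFn_lt g h]
    exact c.F_one i
  · rw [stepFn_ge g h]
    exact c.F_mono h hg

theorem one_mem (c : Coding δ F Φ N m) (i : ℕ) : (1 : ℕ → G) i ∈ F i := c.F_one i

theorem dist_stepValue (c : Coding δ F Φ N m) {j : ℕ} (hj : m ≤ j) {g : G} (hg : g ∈ F j) {n : ℕ}
    (hn : N j ≤ n) :
    δ (stepValue Φ N j g) (ratio Φ (stepFn j g) 1 n) ≤ (1 / 2) ^ j :=
  c.osc j hj _ _ (c.stepFn_mem hg) c.one_mem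
    (fun i hi => by simp [stepFn_ge g hi, stepFn_ge g le_rfl]) _ le_rfl _ hn

/-- Steps starting at j and at k differ only in [j, k), by exchanges of g with 1, and each effect
has settled at its starting time. -/
theorem stepValue_cauchy (c : Coding δ F Φ N m) {g : G} (hg : ∃ i, g ∈ F i)
    (h : Negligible δ F Φ N m {(g, 1)}) {η : ℝ} (hη : 0 < η) :
    ∃ j₀, ∀ j ≥ j₀, ∀ k ≥ j, δ (stepValue Φ N j g) (stepValue Φ N k g) ≤ η := by
  obtain ⟨j₁, hj₁m, hj₁⟩ := h (η / 2) (half_pos hη)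
  obtain ⟨i₀, hi₀⟩ := hg
  obtain ⟨j₂, hj₂, hε⟩ := exists_half_pow_le (max (j₁ + 1) i₀) (half_pos hη)
  refine ⟨j₂, fun j hj k hk => ?_⟩
  have hFj : g ∈ F j := c.F_mono (by omega) hi₀
  have hFk : g ∈ F k := c.F_mono (by omega) hi₀
  have t1 := c.dist_stepValue (by omega) hFj (c.N_mono.monotone hk)
  have t2 := hj₁ (stepFn j g) (stepFn k g) k (c.stepFn_mem hFj) (c.stepFn_mem hFk)
    (fun i hi => by rw [stepFn_lt g (by omega), stepFn_lt g (by omega)])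
    (fun i hi => by rw [stepFn_ge g (by omega), stepFn_ge g (by omega)])
    (fun i => by
      rcases lt_or_ge i j with h1 | h1
      · left
        rw [stepFn_lt g h1, stepFn_lt g (by omega)]
      · rcases lt_or_ge i k with h2 | h2
        · right
          rw [stepFn_ge g h1, stepFn_lt g h2]
          rfl
        · left
          rw [stepFn_ge g h1, stepFn_ge g h2]) (N k) le_rfl
  rw [← ratio_mul (stepFn j g) 1 (stepFn k g)] at t2
  have t3 : ratio Φ 1 (stepFn k g) (N k) = (stepValue Φ N k g)⁻¹ := by simp [ratio, stepValue]
  rw [t3, c.dist.div_one] at t2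
  have t4 := c.dist.triangle (stepValue Φ N j g) (ratio Φ (stepFn j g) 1 (N k)) (stepValue Φ N k g)
  have t5 : (1 / 2 : ℝ) ^ j ≤ η / 2 := (half_pow_anti hj).trans hε
  linarith

/-- Compare y₁ = (1, …, 1, gh, g, g, …) with y₂ = (1, …, 1, h, 1, 1, …), where gh and h stand at
place j. Their quotient is g from j on, so its effect has settled at N j. At that time they look
like steps of height gh and h; at N (j + 1) negligible exchanges turn them into the step of height g
and 1. -/
theorem stepValue_mul (c : Coding δ F Φ N m) {g h : G} (hg : ∃ i, g ∈ F i) (hh : ∃ i, h ∈ F i)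
    (hgh : ∃ i, g * h ∈ F i) (h1 : Negligible δ F Φ N m {(g * h, g)})
    (h2 : Negligible δ F Φ N m {(h, 1)}) {η : ℝ} (hη : 0 < η) :
    ∃ j₀, ∀ j ≥ j₀, δ (stepValue Φ N j (g * h)) (stepValue Φ N j g * stepValue Φ N j h) ≤ η := by
  obtain ⟨j₁, hj₁m, hj₁⟩ := h1 (η / 3) (by positivity)
  obtain ⟨j₂, hj₂m, hj₂⟩ := h2 (η / 3) (by positivity)
  obtain ⟨i₁, hi₁⟩ := hg
  obtain ⟨i₂, hi₂⟩ := hh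
  obtain ⟨i₃, hi₃⟩ := hgh
  obtain ⟨j₀, hj₀, hε⟩ := exists_half_pow_le (max (max (j₁ + 1) (j₂ + 1)) (max i₁ (max i₂ i₃)))
    (show 0 < η / 12 by positivity)
  refine ⟨j₀, fun j hj => ?_⟩
  have hmj : m ≤ j := by omega
  have hFg : g ∈ F j := c.F_mono (by omega) hi₁
  have hFh : h ∈ F j := c.F_mono (by omega) hi₂
  have hFgh : g * h ∈ F j := c.F_mono (by omega) hi₃
  have hεj : (1 / 2 : ℝ) ^ j ≤ η / 12 := (half_pow_anti hj).trans hε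
  let y₁ : ℕ → G := fun i => if i = j then g * h else stepFn j g i
  let y₂ : ℕ → G := fun i => if i = j then h else 1
  have hy₁ : ∀ i, y₁ i ∈ F i := fun i => by
    dsimp only [y₁]
    split_ifs with hij
    · rwa [hij]
    · exact c.stepFn_mem hFg i
  have hy₂ : ∀ i, y₂ i ∈ F i := fun i => by
    dsimp only [y₂]
    split_ifs with hij
    · rwa [hij]
    · exact c.F_one i
  have hgtj : ∀ i ≥ j + 1, y₁ i = g ∧ y₂ i = 1 := fun i hi => by
    have : i ≠ j := by omega
    simp [y₁, y₂, this, stepFn_ge g (show j ≤ i by omega)]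
  have t1 := hj₁ y₁ (stepFn j g) (j + 1) hy₁ (c.stepFn_mem hFg)
    (fun i hi => by simp only [y₁]; rw [if_neg (by omega)])
    (fun i hi => by rw [(hgtj i hi).1, stepFn_ge g (by omega)])
    (fun i => by
      by_cases hij : i = j
      · right
        simp [y₁, hij, stepFn_ge g (le_refl j)]
      · left
        simp [y₁, hij]) (N (j + 1)) le_rfl
  have t2 := hj₂ y₂ 1 (j + 1) hy₂ c.one_mem
    (fun i hi => by simp only [y₂]; rw [if_neg (by omega)]; rfl)
    (fun i hi => by rw [(hgtj i hi).2]; rfl)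
    (fun i => by
      by_cases hij : i = j
      · right
        simp [y₂, hij]
      · left
        simp [y₂, hij]) (N (j + 1)) le_rfl
  have hNj : N j ≤ N (j + 1) := (c.N_mono (Nat.lt_succ_self j)).le
  have t3 := c.dist_stepValue hmj hFg hNj
  have t4 := c.osc j hmj y₁ y₂ hy₁ hy₂ (fun i hi => by
    rcases eq_or_lt_of_le hi with rfl | hi
    · rfl
    · rw [(hgtj i hi).1, (hgtj i hi).2]
      simp [y₁, y₂]) (N j) le_rfl _ hNj
  have t5 := c.ratio_near hmj (c.stepFn_mem hFgh) (c.stepFn_mem hFh) hy₁ hy₂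
    (fun i hi => by
      rcases eq_or_lt_of_le hi with rfl | hi
      · simp [y₁, stepFn_ge (g * h) (le_refl i)]
      · simp only [y₁]
        rw [if_neg (by omega), stepFn_lt _ hi, stepFn_lt _ hi])
    (fun i hi => by
      rcases eq_or_lt_of_le hi with rfl | hi
      · simp [y₂, stepFn_ge h (le_refl i)]
      · simp only [y₂]
        rw [if_neg (by omega), stepFn_lt _ hi]) (le_refl (N j))
  have e1 : δ (stepValue Φ N j (g * h)) (stepValue Φ N j g * stepValue Φ N j h) =
      δ (ratio Φ (stepFn j (g * h)) (stepFn j h) (N j)) (stepValue Φ N j g) := by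
    rw [← c.dist.mul_right (stepValue Φ N j h) (ratio Φ (stepFn j (g * h)) (stepFn j h) (N j)),
      stepValue, stepValue, stepValue, ratio_mul]
  have e2 : δ (ratio Φ y₁ y₂ (N (j + 1))) (ratio Φ (stepFn j g) 1 (N (j + 1))) ≤
      δ (ratio Φ y₁ (stepFn j g) (N (j + 1))) 1 + δ (ratio Φ y₂ 1 (N (j + 1))) 1 := by
    rw [← ratio_mul y₁ (stepFn j g) y₂, ← ratio_mul (stepFn j g) 1 y₂, c.dist_ratio_comm y₂ 1]
    have := c.dist.mul_mul (ratio Φ y₁ (stepFn j g) (N (j + 1)))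
      (ratio Φ (stepFn j g) 1 (N (j + 1)) * ratio Φ 1 y₂ (N (j + 1))) 1
      (ratio Φ (stepFn j g) 1 (N (j + 1)))
    rw [one_mul] at this
    refine this.trans (le_of_eq ?_)
    congr 1
    have := c.dist.mul_left (ratio Φ (stepFn j g) 1 (N (j + 1))) (ratio Φ 1 y₂ (N (j + 1))) 1
    rwa [mul_one] at this
  rw [e1]
  have s1 := c.dist.triangle (ratio Φ (stepFn j (g * h)) (stepFn j h) (N j))
    (ratio Φ y₁ y₂ (N j)) (stepValue Φ N j g)
  have s2 := c.dist.triangle (ratio Φ y₁ y₂ (N j)) (ratio Φ y₁ y₂ (N (j + 1)))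
    (stepValue Φ N j g)
  have s3 := c.dist.triangle (ratio Φ y₁ y₂ (N (j + 1))) (ratio Φ (stepFn j g) 1 (N (j + 1)))
    (stepValue Φ N j g)
  rw [c.dist.comm (ratio Φ (stepFn j g) 1 (N (j + 1)))] at s3
  linarith

theorem stepValue_small (c : Coding δ F Φ N m) {d : G → G → ℝ} (hd : IsCompatDist d)
    {η : ℝ} (hη : 0 < η) :
    ∃ ρ > 0, ∃ j₀, ∀ j ≥ j₀, ∀ g ∈ F j, d g 1 < ρ → δ (stepValue Φ N j g) 1 ≤ η := by
  obtain ⟨ρ, hρ, j₀, -, h⟩ := c.exists_forall_small hd hη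
  refine ⟨ρ, hρ, j₀ + 1, fun j hj g hg hgρ =>
    h _ _ (c.stepFn_mem hg) c.one_mem (fun i hi => stepFn_lt g (by omega)) (fun i => ?_) _⟩
  rcases lt_or_ge i j with h | h
  · rw [stepFn_lt g h, Pi.one_apply, hd.self]
    exact hρ
  · rwa [stepFn_ge g h]

/-! ### Slow paths and excursions -/

/-- A slow path through finitely many interchangeable elements whose steps have small values
has a small effect at all times. -/
theorem exists_forall_path (c : Coding δ F Φ N m) {d : G → G → ℝ} (hd : IsCompatDist d)
    {η : ℝ} (hη : 0 < η) : ∃ ρ > 0, ∀ C : Set G, C.Finite → 1 ∈ C →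
      (∀ a ∈ C, ∀ b ∈ C, Negligible δ F Φ N m {(a, b)}) → ∃ j₀, ∀ K ≥ j₀, ∀ x : ℕ → G,
        (∀ i ≤ K, x i = 1) → (∀ i, x i ∈ C) → (∀ i, d (x i) (x (i + 1)) < ρ) → C ⊆ F K →
        (∀ a ∈ C, δ (stepValue Φ N K a) 1 ≤ η) → ∀ n, δ (ratio Φ x 1 n) 1 ≤ 4 * η := by
  obtain ⟨ρ, hρ, j₁, hj₁m, hsmall⟩ := c.exists_forall_small hd hη
  refine ⟨ρ, hρ, fun C hC hC1 hneg => ?_⟩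
  obtain ⟨j₂, hj₂m, hj₂⟩ := c.negligible_of_finite (hC.prod hC) (by
    rintro ⟨a, b⟩ ⟨ha, hb⟩
    exact hneg a ha b hb) η hη
  obtain ⟨j₀, hj₀, hε⟩ := exists_half_pow_le (max j₁ (j₂ + 1)) (half_pos hη)
  refine ⟨j₀, fun K hK x hx1 hxC hxd hCF hCη n => ?_⟩
  have hmK : m ≤ K := by omega
  have hεK : (1 / 2 : ℝ) ^ K ≤ η / 2 := (half_pow_anti hK).trans hε
  have hx : ∀ i, x i ∈ F i := fun i => by
    rcases le_total i K with hi | hi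
    · rw [hx1 i hi]
      exact c.F_one i
    · exact c.F_mono hi (hCF (hxC i))
  -- The path frozen at time j differs from the step of height x j by negligible exchanges within C,
  -- so its effect from N j on is controlled.
  let z : ℕ → ℕ → G := fun j i => x (min i j)
  have hzC : ∀ j i, z j i ∈ C := fun j i => hxC _
  have hz1 : ∀ j, ∀ i ≤ K, z j i = 1 := fun j i hi => hx1 _ ((min_le_left _ _).trans hi)
  have hz : ∀ j i, z j i ∈ F i := fun j i => by
    rcases le_total i K with hi | hi
    · rw [hz1 j i hi]
      exact c.F_one i
    · exact c.F_mono hi (hCF (hxC _))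
  have hfrozen : ∀ j ≥ K, ∀ n ≥ N j, δ (ratio Φ (z j) 1 n) 1 ≤ 2 * η + (1 / 2) ^ K := by
    intro j hj n hn
    have hF : x j ∈ F K := hCF (hxC j)
    have t1 := hj₂ (z j) (stepFn K (x j)) j (hz j) (c.stepFn_mem hF)
      (fun i hi => by rw [stepFn_lt _ (by omega), hz1 j i (by omega)])
      (fun i hi => by
        rw [stepFn_ge _ (by omega)]
        simp only [z, min_eq_right hi])
      (fun i => by
        rcases lt_or_ge i K with hi | hi
        · left
          rw [stepFn_lt _ hi, hz1 j i hi.le]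
        · right
          rw [stepFn_ge _ hi]
          exact ⟨hzC j i, hxC j⟩) n hn
    have t2 := c.dist_stepValue hmK hF ((c.N_mono.monotone hj).trans hn)
    have t3 := c.dist_ratio_triangle (z j) (stepFn K (x j)) 1 n
    have t4 := c.dist.triangle (ratio Φ (stepFn K (x j)) 1 n) (stepValue Φ N K (x j)) 1
    rw [c.dist.comm _ (stepValue Φ N K (x j))] at t4
    have t5 := hCη _ (hxC j)
    linarith
  rcases le_total n (N K) with hn | hn
  · have := c.ratio_near_one hmK hx c.one_mem hx1 hn
    linarith
  · obtain ⟨j, hjK, hj1, hj2⟩ := exists_mem_block c.N_mono hn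
    -- Between N j and N (j + 1), x looks like its freezing at j + 1, which differs from the
    -- freezing at j by the single small increment x j to x (j + 1), repeated forever.
    have t1 := c.near (j + 1) (by omega) x (z (j + 1)) hx (hz _)
      (fun i hi => by simp only [z, min_eq_left hi]) n hj2.le
    have t2 := hsmall (z (j + 1)) (z j) (hz _) (hz _)
      (fun i hi => by
        simp only [z]
        rw [min_eq_left (by omega), min_eq_left (by omega)])
      (fun i => by
        rcases le_or_gt i j with hi | hi
        · simp only [z]
          rw [min_eq_left (by omega), min_eq_left (by omega), hd.self]
          exact hρ
        · simp only [z]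
          rw [min_eq_right (by omega), min_eq_right (by omega), hd.comm]
          exact hxd j) n
    have t3 := hfrozen j hjK n hj1
    have t4 := c.dist_ratio_triangle (z (j + 1)) (z j) 1 n
    have t5 := c.dist_ratio_triangle x (z (j + 1)) 1 n
    rw [c.dist_ratio_one x] at t5
    have t6 : (1 / 2 : ℝ) ^ (j + 1) ≤ (1 / 2) ^ K := half_pow_anti (by omega)
    rw [c.dist_ratio_one] at t5 ⊢
    rw [← c.dist_ratio_one x 1 n] at t5 ⊢
    linarith

/-- Concatenating excursions from `1` with summable effects gives a Cauchy sequence. -/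
theorem cauchy_of_excursions (c : Coding δ F Φ N m) {x : ℕ → ℕ → G} {e s : ℕ → ℕ}
    (hs : StrictMono s) (hs1 : ∀ i, s (i + 1) = e (s i) + 1) (hx : ∀ k i, x k i ∈ F i)
    (hxl : ∀ k, ∀ i ≤ k, x k i = 1) (hxr : ∀ k, ∀ i ≥ e k, x k i = 1)
    (hxs : ∀ k ≥ m, ∀ n, δ (ratio Φ (x k) 1 n) 1 ≤ (1 / 2) ^ k) {η : ℝ} (hη : 0 < η) :
    ∃ n₀, ∀ n ≥ n₀, δ (ratio Φ (fun t => x (s (blk s t)) t) 1 n)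
      (ratio Φ (fun t => x (s (blk s t)) t) 1 n₀) < η := by
  let X : ℕ → G := fun t => x (s (blk s t)) t
  have hX : ∀ i, X i ∈ F i := fun i => hx _ i
  -- A block costs 8 = 7 + 1 (locality and the effect itself), the geometric sum at most 16, and the
  -- last partial block 8 more: 24 < 25.
  obtain ⟨i₀, hi₀m, hε⟩ := exists_half_pow_le m (show 0 < η / 25 by positivity)
  have hblock : ∀ i ≥ m, ∀ n, N (s i) ≤ n → n ≤ N (s (i + 1)) →
      δ (ratio Φ X 1 (N (s i))) (ratio Φ X 1 n) ≤ 8 * (1 / 2) ^ s i := by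
    intro i hi n hn1 hn2
    have hmi : m ≤ s i := hi.trans hs.le_apply
    have t := (c.ratio_local hmi (hs (Nat.lt_succ_self i)).le (hx (s i)) c.one_mem hX c.one_mem
      (hxl _) (fun t ht1 ht2 => by
        -- The right endpoint belongs to the next block, but both excursions take the value 1 there.
        rcases eq_or_lt_of_le ht2 with rfl | ht2
        · have hb : blk s (s i.succ) = i.succ := blk_eq hs le_rfl (hs (Nat.lt_succ_self _))
          simp only [X, hb]
          rw [hxl _ _ le_rfl, hxr _ _ (by have := hs1 i; simp only [Nat.succ_eq_add_one]; omega)]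
        · simp only [X, blk_eq hs ht1 ht2])
      (fun t _ _ => rfl) hn1 hn2).1
    have := hxs (s i) hmi n
    linarith
  have hsum : ∀ l, δ (ratio Φ X 1 (N (s i₀))) (ratio Φ X 1 (N (s (i₀ + l)))) ≤
      16 * ((1 / 2) ^ s i₀ - (1 / 2) ^ s (i₀ + l)) := by
    intro l
    induction l with
    | zero => simp [c.dist.self]
    | succ l ih =>
      have t1 := hblock (i₀ + l) (by omega) (N (s (i₀ + l + 1)))
        (c.N_mono.monotone (hs (Nat.lt_succ_self _)).le) le_rfl
      have t2 := c.dist.triangle (ratio Φ X 1 (N (s i₀))) (ratio Φ X 1 (N (s (i₀ + l))))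
        (ratio Φ X 1 (N (s (i₀ + l + 1))))
      have t3 : (1 / 2 : ℝ) ^ s (i₀ + l + 1) ≤ (1 / 2) ^ (s (i₀ + l) + 1) :=
        half_pow_anti (hs (Nat.lt_succ_self (i₀ + l)))
      rw [pow_succ] at t3
      rw [← add_assoc]
      linarith
  refine ⟨N (s i₀), fun n hn => ?_⟩
  obtain ⟨l, hl, hl1, hl2⟩ := exists_mem_block (c.N_mono.comp hs) hn
  obtain ⟨q, rfl⟩ := Nat.exists_eq_add_of_le hl
  have t1 := hsum q
  have t2 := hblock (i₀ + q) (by omega) n hl1 hl2.le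
  have t3 := c.dist.triangle (ratio Φ X 1 (N (s i₀))) (ratio Φ X 1 (N (s (i₀ + q))))
    (ratio Φ X 1 n)
  rw [c.dist.comm]
  have t4 : (1 / 2 : ℝ) ^ s (i₀ + q) ≤ (1 / 2) ^ s i₀ := half_pow_anti (hs.monotone (by omega))
  have t5 : (1 / 2 : ℝ) ^ s i₀ ≤ (1 / 2) ^ i₀ := half_pow_anti hs.le_apply
  have t6 : (0 : ℝ) < (1 / 2) ^ s (i₀ + q) := by positivity
  change δ (ratio Φ X 1 (N (s i₀))) (ratio Φ X 1 n) < η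
  linarith

end Coding

/-! ### Extending the limit homomorphism -/

/-- A uniformly continuous homomorphism on a dense subgroup of an open subgroup extends. -/
theorem exists_extension {G K : Type*} [Group G] [TopologicalSpace G] [Group K]
    [TopologicalSpace K] [IsTopologicalGroup K] [PolishSpace K] {d : G → G → ℝ}
    (hd : IsCompatDist d) {dK : K → K → ℝ} (hdK : IsCompatDist dK) {Γ V : Subgroup G}
    (hV : IsOpen (V : Set G)) (hΓ : Dense (Γ : Set G)) (f : G → K)
    (hf : ∀ a ∈ Γ, a ∈ V → ∀ b ∈ Γ, b ∈ V → f (a * b) = f a * f b)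
    (hs : ∀ η > 0, ∃ ρ > 0, ∀ a ∈ Γ, a ∈ V → d a 1 < ρ → dK (f a) 1 ≤ η) :
    ∃ F : G → K, (∀ u ∈ V, ∀ v ∈ V, F (u * v) = F u * F v) ∧ (∀ v ∈ V, ContinuousAt F v) ∧
      ∀ a ∈ Γ, a ∈ V → F a = f a := by
  have hunif : ∀ η > 0, ∃ ρ > 0, ∀ a ∈ Γ, a ∈ V → ∀ b ∈ Γ, b ∈ V → d a b < ρ →
      dK (f a) (f b) ≤ η := by
    intro η hη
    obtain ⟨ρ, hρ, h⟩ := hs η hη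
    refine ⟨ρ, hρ, fun a ha haV b hb hbV hab => ?_⟩
    -- Writing f a = f (a * b⁻¹) * f b, invariance upgrades smallness near 1 to uniform continuity.
    have h1 := hf (a * b⁻¹) (Γ.mul_mem ha (Γ.inv_mem hb)) (V.mul_mem haV (V.inv_mem hbV)) b hb hbV
    rw [inv_mul_cancel_right] at h1
    have h2 := hdK.mul_right (f b) (f (a * b⁻¹)) 1
    rw [one_mul, ← h1] at h2
    rw [h2]
    exact h _ (Γ.mul_mem ha (Γ.inv_mem hb)) (V.mul_mem haV (V.inv_mem hbV)) (by
      rwa [hd.div_one])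
  have happ : ∀ v ∈ V, ∀ ε > 0, ∃ a ∈ Γ, a ∈ V ∧ d a v < ε := by
    intro v hv ε hε
    obtain ⟨a, ha, ha'⟩ := hΓ.exists_mem_open (hV.inter (hd.isOpen_ball v ε)) ⟨v, hv, by
      change d v v < ε
      rwa [hd.self]⟩
    exact ⟨a, ha, ha'.1, ha'.2⟩
  have hlim : ∀ v ∈ V, ∃ k, ∀ η > 0, ∃ ρ > 0, ∀ a ∈ Γ, a ∈ V → d a v < ρ → dK (f a) k ≤ η := by
    intro v hv
    choose a ha haV had using fun n : ℕ => happ v hv ((1 / 2) ^ n) (by positivity)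
    have hclose : ∀ ρ > 0, ∃ n₀, ∀ n ≥ n₀, d (a n) v < ρ := by
      intro ρ hρ
      obtain ⟨n₀, -, hn₀⟩ := exists_half_pow_le 0 hρ
      exact ⟨n₀, fun n hn => (had n).trans_le ((half_pow_anti hn).trans hn₀)⟩
    obtain ⟨k, hk⟩ := hdK.exists_tendsto (fun n => f (a n)) (by
      intro ε hε
      obtain ⟨ρ, hρ, h⟩ := hunif (ε / 2) (half_pos hε)
      obtain ⟨n₀, hn₀⟩ := hclose (ρ / 2) (half_pos hρ)
      refine ⟨n₀, fun n hn => (h _ (ha _) (haV _) _ (ha _) (haV _) ?_).trans_lt (by linarith)⟩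
      have t1 := hn₀ n hn
      have t2 := hn₀ n₀ le_rfl
      have t3 := hd.triangle (a n) v (a n₀)
      rw [hd.comm v] at t3
      linarith)
    refine ⟨k, fun η hη => ?_⟩
    obtain ⟨ρ, hρ, h⟩ := hunif (η / 2) (half_pos hη)
    obtain ⟨n₀, hn₀⟩ := hclose (ρ / 2) (half_pos hρ)
    refine ⟨ρ / 2, half_pos hρ, fun b hb hbV hbd => ?_⟩
    obtain ⟨n, hn, hnk⟩ := ((eventually_ge_atTop n₀).and
      (hdK.tendsto_iff.1 hk (η / 2) (half_pos hη))).exists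
    have t1 := hn₀ n hn
    have t2 := hd.triangle b v (a n)
    rw [hd.comm v] at t2
    have t3 := h b hb hbV (a n) (ha n) (haV n) (by linarith)
    have t4 := hdK.triangle (f b) (f (a n)) k
    linarith
  choose! F hF using hlim
  refine ⟨F, fun u hu v hv => ?_, fun v hv => ?_, fun a ha haV => ?_⟩
  · refine hdK.eq_of_dist fun ε hε => ?_
    obtain ⟨ρ₁, hρ₁, h1⟩ := hF u hu (ε / 4) (by positivity)
    obtain ⟨ρ₂, hρ₂, h2⟩ := hF v hv (ε / 4) (by positivity)
    obtain ⟨ρ₃, hρ₃, h3⟩ := hF (u * v) (V.mul_mem hu hv) (ε / 4) (by positivity)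
    obtain ⟨a, ha, haV, had⟩ := happ u hu (min ρ₁ (ρ₃ / 2)) (by positivity)
    obtain ⟨b, hb, hbV, hbd⟩ := happ v hv (min ρ₂ (ρ₃ / 2)) (by positivity)
    have t1 := h1 a ha haV (had.trans_le (min_le_left _ _))
    have t2 := h2 b hb hbV (hbd.trans_le (min_le_left _ _))
    have t3 := h3 (a * b) (Γ.mul_mem ha hb) (V.mul_mem haV hbV) (by
      have := hd.mul_mul a b u v
      have := had.trans_le (min_le_right _ _)
      have := hbd.trans_le (min_le_right _ _)
      linarith)
    rw [hf a ha haV b hb hbV] at t3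
    have t4 := hdK.triangle (F (u * v)) (f a * f b) (F u * F v)
    rw [hdK.comm (F (u * v)) (f a * f b)] at t4
    have t5 := hdK.mul_mul (f a) (f b) (F u) (F v)
    linarith
  · rw [ContinuousAt, hdK.tendsto_iff]
    intro ε hε
    obtain ⟨ρ, hρ, h⟩ := hF v hv (ε / 3) (by positivity)
    filter_upwards [hV.mem_nhds hv, hd.ball_mem v (half_pos hρ)] with u hu hud
    obtain ⟨ρ', hρ', h'⟩ := hF u hu (ε / 3) (by positivity)
    obtain ⟨a, ha, haV, had⟩ := happ u hu (min ρ' (ρ / 2)) (by positivity)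
    have t1 := h' a ha haV (had.trans_le (min_le_left _ _))
    have t2 := h a ha haV (by
      have := hd.triangle a u v
      have := had.trans_le (min_le_right _ _)
      linarith)
    have t3 := hdK.triangle (F u) (f a) (F v)
    rw [hdK.comm (F u) (f a)] at t3
    linarith
  · refine hdK.eq_of_dist fun ε hε => ?_
    obtain ⟨ρ, hρ, h⟩ := hF a haV (ε / 2) (half_pos hε)
    have := h a ha haV (by rwa [hd.self])
    rw [hdK.comm]
    linarith

namespace Coding

/-- The homomorphism with values in a Polish group determined by a coding. -/
theorem exists_hom {G H K : Type*} [Group G] [TopologicalSpace G] [IsTopologicalGroup G] [Group H]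
    [Group K] [TopologicalSpace K] [IsTopologicalGroup K] [PolishSpace K] {dK : K → K → ℝ}
    (hdK : IsCompatDist dK) (hK : IsStronglyNSS K) (p : H →* K)
    {F : ℕ → Set G} {Φ : (ℕ → G) → ℕ → H} {N : ℕ → ℕ} {m : ℕ}
    (c : Coding (fun a b => dK (p a) (p b)) F Φ N m) {d : G → G → ℝ} (hd : IsCompatDist d)
    {Γ : Subgroup G} (hΓ : Dense (Γ : Set G)) (hΓF : ∀ g ∈ Γ, ∃ i, g ∈ F i) :
    ∃ (V : Subgroup G) (S : G → K), IsOpen (V : Set G) ∧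
      (∀ a ∈ Γ, ∀ b ∈ Γ, a * b⁻¹ ∈ V →
        Negligible (fun a b => dK (p a) (p b)) F Φ N m {(a, b)}) ∧
      (∀ u ∈ V, ∀ v ∈ V, S (u * v) = S u * S v) ∧ (∀ v ∈ V, ContinuousAt S v) ∧
      ∀ a ∈ Γ, a ∈ V → Tendsto (fun j => p (stepValue Φ N j a)) atTop (𝓝 (S a)) := by
  obtain ⟨V, hV, hneg⟩ := c.exists_open_subgroup (hK.noSmallProducts hdK p) hd hΓ hΓF
  have hlim : ∀ a ∈ Γ, a ∈ V → ∃ k, Tendsto (fun j => p (stepValue Φ N j a)) atTop (𝓝 k) := by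
    intro a ha haV
    apply hdK.exists_tendsto
    intro ε hε
    obtain ⟨j₀, h⟩ := c.stepValue_cauchy (hΓF a ha) (hneg a ha 1 Γ.one_mem (by simpa using haV))
      (half_pos hε)
    refine ⟨j₀, fun n hn => ?_⟩
    rw [hdK.comm]
    exact (h j₀ le_rfl n hn).trans_lt (by linarith)
  choose! f hf using hlim
  obtain ⟨S, hSmul, hScont, hSf⟩ := exists_extension hd hdK hV hΓ f
    (fun a ha haV b hb hbV => by
      refine hdK.eq_of_dist fun ε hε => ?_
      obtain ⟨j₀, h⟩ := c.stepValue_mul (hΓF a ha) (hΓF b hb) (hΓF _ (Γ.mul_mem ha hb))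
        (hneg _ (Γ.mul_mem ha hb) a ha (V.mul_mem (V.mul_mem haV hbV) (V.inv_mem haV)))
        (hneg b hb 1 Γ.one_mem (by simpa using hbV)) (show 0 < ε / 3 by positivity)
      have h1 := hdK.tendsto_iff.1 (hf _ (Γ.mul_mem ha hb) (V.mul_mem haV hbV)) (ε / 3)
        (by positivity)
      have h2 := hdK.tendsto_iff.1 ((hf a ha haV).mul (hf b hb hbV)) (ε / 3) (by positivity)
      obtain ⟨j, ⟨t1, t2⟩, hj⟩ := ((h1.and h2).and (eventually_ge_atTop j₀)).exists
      have t3 := h j hj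
      rw [map_mul] at t3
      have t4 := hdK.triangle (f (a * b)) (p (stepValue Φ N j (a * b))) (f a * f b)
      have t5 := hdK.triangle (p (stepValue Φ N j (a * b)))
        (p (stepValue Φ N j a) * p (stepValue Φ N j b)) (f a * f b)
      rw [hdK.comm (f (a * b)) (p (stepValue Φ N j (a * b)))] at t4
      linarith)
    (fun η hη => by
      obtain ⟨ρ, hρ, j₀, h⟩ := c.stepValue_small hd (half_pos hη)
      refine ⟨ρ, hρ, fun a ha haV had => ?_⟩
      obtain ⟨i, hi⟩ := hΓF a ha
      obtain ⟨j, t1, hj⟩ := ((hdK.tendsto_iff.1 (hf a ha haV) (η / 2) (half_pos hη)).and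
        (eventually_ge_atTop (max i j₀))).exists
      have t2 := h j ((le_max_right _ _).trans hj) a (c.F_mono ((le_max_left _ _).trans hj) hi) had
      rw [map_one] at t2
      have t3 := hdK.triangle (f a) (p (stepValue Φ N j a)) 1
      rw [hdK.comm (f a) (p (stepValue Φ N j a))] at t3
      linarith)
  exact ⟨V, S, hV, hneg, hSmul, hScont, fun a ha haV => by
    rw [hSf a ha haV]
    exact hf a ha haV⟩

end Coding

/-! ### The kernel is non-archimedean -/

/-- An element of the subgroup generated by small elements is reached by a path with small
steps. -/
theorem Subgroup.exists_path_of_mem_closure {G : Type*} [Group G] {d : G → G → ℝ}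
    (hd : IsInvDist d) {L : Subgroup G} {ε : ℝ} (hε : 0 < ε) {k : G}
    (hk : k ∈ Subgroup.closure {g | g ∈ L ∧ d g 1 < ε}) :
    ∃ (q : ℕ) (c : ℕ → G), c 0 = 1 ∧ c q = k ∧ (∀ i, c i ∈ L) ∧ ∀ i, d (c i) (c (i + 1)) < ε := by
  have hstep : ∀ a g : G, g ∈ L → d g 1 < ε → (∃ (q : ℕ) (c : ℕ → G), c 0 = 1 ∧ c q = a ∧
      (∀ i, c i ∈ L) ∧ ∀ i, d (c i) (c (i + 1)) < ε) → ∃ (q : ℕ) (c : ℕ → G), c 0 = 1 ∧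
      c q = a * g ∧ (∀ i, c i ∈ L) ∧ ∀ i, d (c i) (c (i + 1)) < ε := by
    rintro a g hg hgε ⟨q, c, h0, hq, hL, hc⟩
    refine ⟨q + 1, fun i => if i ≤ q then c i else a * g, by simp [h0], by simp, fun i => ?_,
      fun i => ?_⟩
    · dsimp only
      split_ifs
      · exact hL i
      · exact L.mul_mem (hq ▸ hL q) hg
    · dsimp only
      rcases lt_trichotomy i q with h | rfl | h
      · rw [if_pos h.le, if_pos (by omega)]
        exact hc i
      · rw [if_pos le_rfl, if_neg (by omega), hq]
        have := hd.mul_left a 1 g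
        rw [mul_one] at this
        rw [this, hd.comm]
        exact hgε
      · rw [if_neg (by omega), if_neg (by omega), hd.self]
        exact hε
  induction hk using Subgroup.closure_induction_right with
  | one => exact ⟨0, fun _ => 1, rfl, rfl, fun _ => L.one_mem, fun _ => by rwa [hd.self]⟩
  | mul_right a _ g hg ih => exact hstep a g hg.1 hg.2 ih
  | mul_inv_cancel a _ g hg ih =>
    exact hstep a g⁻¹ (L.inv_mem hg.1) (by rw [hd.inv_one]; exact hg.2) ih

theorem exists_pos_le_of_forall_pos {r : ℕ → ℝ} (hr : ∀ m, 0 < r m) (k : ℕ) :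
    ∃ ε > 0, ∀ m ≤ k, ε ≤ r m := by
  induction k with
  | zero => exact ⟨r 0, hr 0, fun m hm => by rw [Nat.le_zero.1 hm]⟩
  | succ k ih =>
    obtain ⟨ε, hε, h⟩ := ih
    refine ⟨min ε (r (k + 1)), lt_min hε (hr _), fun m hm => ?_⟩
    rcases Nat.lt_or_ge m (k + 1) with h1 | h1
    · exact (min_le_left _ _).trans (h m (by omega))
    · rw [le_antisymm hm h1]
      exact min_le_right _ _

theorem exists_tendsto_of_coord_cauchy {K : ℕ → Type*} [∀ m, Group (K m)]
    [∀ m, TopologicalSpace (K m)] [∀ m, IsTopologicalGroup (K m)] [∀ m, PolishSpace (K m)]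
    {dK : ∀ m, K m → K m → ℝ} (hdK : ∀ m, IsCompatDist (dK m)) (H : Subgroup (∀ m, K m))
    (hH : IsClosed (H : Set (∀ m, K m))) (u : ℕ → H)
    (hu : ∀ m, ∀ ε > 0, ∃ n₀, ∀ n ≥ n₀, dK m (coordHom H m (u n)) (coordHom H m (u n₀)) < ε) :
    ∃ a, Tendsto u atTop (𝓝 a) := by
  choose a ha using fun m => (hdK m).exists_tendsto (fun n => coordHom H m (u n)) (hu m)
  have hlim : Tendsto (fun n => (u n : ∀ m, K m)) atTop (𝓝 a) := tendsto_pi_nhds.2 ha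
  have haH : a ∈ H := hH.mem_of_tendsto hlim (Eventually.of_forall fun n => (u n).2)
  exact ⟨⟨a, haH⟩, tendsto_subtype_rng.2 hlim⟩

theorem exists_approx {G : Type*} [Group G] [TopologicalSpace G] {K : ℕ → Type*}
    [∀ m, Group (K m)] [∀ m, TopologicalSpace (K m)] {dK : ∀ m, K m → K m → ℝ} {d : G → G → ℝ}
    {Γ : Subgroup G} {V : ℕ → Subgroup G} {S : ∀ m, G → K m} (hdK : ∀ m, IsCompatDist (dK m))
    (hd : IsCompatDist d) (hΓ : Dense (Γ : Set G)) (hV : ∀ m, IsOpen (V m : Set G))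
    (hS : ∀ m, ∀ v ∈ V m, ContinuousAt (S m) v) {w : G} (hw : ∀ m, w ∈ V m) (k : ℕ) {ε : ℝ}
    (hε : 0 < ε) :
    ∃ a ∈ Γ, d a w < ε ∧ ∀ m ≤ k, a ∈ V m ∧ dK m (S m a) (S m w) < ε := by
  have h1 : ∀ᶠ a in 𝓝 w, d a w < ε ∧ ∀ m ∈ Set.Iic k, a ∈ V m ∧ dK m (S m a) (S m w) < ε := by
    have h2 : ∀ᶠ a in 𝓝 w, d a w < ε := hd.ball_mem w hε
    refine h2.and ((eventually_all_finite (Set.finite_Iic k)).2 fun m _ => ?_)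
    have h3 : ∀ᶠ a in 𝓝 w, a ∈ V m := (hV m).mem_nhds (hw m)
    exact h3.and ((hS m w (hw m)).eventually ((hdK m).ball_mem _ hε))
  obtain ⟨O, hO, hOo, hwO⟩ := eventually_nhds_iff.1 h1
  obtain ⟨a, ha, haO⟩ := hΓ.exists_mem_open hOo ⟨w, hwO⟩
  exact ⟨a, ha, hO a haO⟩

section

variable {G : Type*} [Group G] [TopologicalSpace G] {K : ℕ → Type*}
  [∀ m, Group (K m)] [∀ m, TopologicalSpace (K m)] {dK : ∀ m, K m → K m → ℝ}
  {H : Subgroup (∀ m, K m)} {F : ℕ → Set G} {Φ : (ℕ → G) → ℕ → H} {N : ℕ → ℕ} {d : G → G → ℝ} {Γ : Subgroup G}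
  {V : ℕ → Subgroup G}
  {S : ∀ m, G → K m}

/-- The values of the limit homomorphism lie in the closed subgroup. -/
theorem limit_mem (hdK : ∀ m, IsCompatDist (dK m)) (hd : IsCompatDist d)
    (hH : IsClosed (H : Set (∀ m, K m))) (hΓ : Dense (Γ : Set G))
    (hV : ∀ m, IsOpen (V m : Set G)) (hS : ∀ m, ∀ v ∈ V m, ContinuousAt (S m) v)
    (hlim : ∀ m, ∀ a ∈ Γ, a ∈ V m →
      Tendsto (fun j => coordHom H m (stepValue Φ N j a)) atTop (𝓝 (S m a)))
    {w : G} (hw : ∀ m, w ∈ V m) : (fun m => S m w) ∈ H := by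
  have h1 : ∀ n : ℕ, ∃ h : H, ∀ m ≤ n, dK m (coordHom H m h) (S m w) < 2 * (1 / 2) ^ n := by
    intro n
    have hpos : (0 : ℝ) < (1 / 2) ^ n := by positivity
    obtain ⟨a, ha, -, haV⟩ := exists_approx hdK hd hΓ hV hS hw n hpos
    have h2 : ∀ᶠ j in atTop, ∀ m ∈ Set.Iic n,
        dK m (coordHom H m (stepValue Φ N j a)) (S m a) < (1 / 2) ^ n :=
      (eventually_all_finite (Set.finite_Iic n)).2 fun m hm =>
        (hdK m).tendsto_iff.1 (hlim m a ha (haV m hm).1) _ hpos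
    obtain ⟨j, hj⟩ := h2.exists
    refine ⟨stepValue Φ N j a, fun m hm => ?_⟩
    have t1 := hj m hm
    have t2 := (haV m hm).2
    have t3 := (hdK m).triangle (coordHom H m (stepValue Φ N j a)) (S m a) (S m w)
    linarith
  choose h hh using h1
  have hlimit : Tendsto (fun n => (h n : ∀ m, K m)) atTop (𝓝 fun m => S m w) := by
    rw [tendsto_pi_nhds]
    intro m
    rw [(hdK m).tendsto_iff]
    intro ε hε
    obtain ⟨n₀, hn₀, hn₀ε⟩ := exists_half_pow_le m (half_pos hε)
    filter_upwards [eventually_ge_atTop n₀] with n hn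
    have t1 := hh n m (by omega)
    have t2 := half_pow_anti hn
    change dK m (coordHom H m (h n)) (S m w) < ε
    linarith
  exact hH.mem_of_tendsto hlimit (Eventually.of_forall fun n => (h n).2)

/-- A path in the kernel with small steps from `1` to `p` yields a sequence that starts and ends
with `1`, comes close to `p`, and has a small effect at all times. -/
theorem exists_excursion (hdK : ∀ m, IsCompatDist (dK m)) (hd : IsCompatDist d)
    (c : ∀ m, Coding (fun a b => dK m (coordHom H m a) (coordHom H m b)) F Φ N m)
    (hΓ : Dense (Γ : Set G)) (hΓF : ∀ g ∈ Γ, ∃ i, g ∈ F i)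
    (hV : ∀ m, IsOpen (V m : Set G)) (hS : ∀ m, ∀ v ∈ V m, ContinuousAt (S m) v)
    (hneg : ∀ m, ∀ a ∈ Γ, ∀ b ∈ Γ, a * b⁻¹ ∈ V m →
      Coding.Negligible (fun a b => dK m (coordHom H m a) (coordHom H m b)) F Φ N m {(a, b)})
    (hlim : ∀ m, ∀ a ∈ Γ, a ∈ V m →
      Tendsto (fun j => coordHom H m (stepValue Φ N j a)) atTop (𝓝 (S m a)))
    (hS1 : ∀ m, S m 1 = 1) {L : Subgroup G} (hL : ∀ g ∈ L, ∀ m, g ∈ V m ∧ S m g = 1) {r : ℝ}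
    (hr : 0 < r) (hpath : ∀ ε > 0, ∃ (q : ℕ) (p : ℕ → G), p 0 = 1 ∧ r ≤ d (p q) 1 ∧
      (∀ i, p i ∈ L) ∧ ∀ i, d (p i) (p (i + 1)) < ε) (k : ℕ) :
    ∃ (x : ℕ → G) (e t : ℕ), k ≤ e ∧ k ≤ t ∧ t ≤ e ∧ (∀ i, x i ∈ F i) ∧ (∀ i ≤ k, x i = 1) ∧
      (∀ i ≥ e, x i = 1) ∧ r / 2 ≤ d (x t) 1 ∧ ∀ m ≤ k, ∀ n,
        dK m (coordHom H m (ratio Φ x 1 n)) (coordHom H m 1) ≤ (1 / 2) ^ k := by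
  have hη : (0 : ℝ) < (1 / 2) ^ k / 4 := by positivity
  -- Only the coordinates m ≤ k are controlled, so one step size ε below all their ρ m exists. It is
  -- fixed before the path and the finite set C.
  choose ρ hρ hρC using fun m => (c m).exists_forall_path hd hη
  obtain ⟨ε, hε, hερ⟩ := exists_pos_le_of_forall_pos hρ k
  obtain ⟨q, p, hp0, hpq, hpL, hp⟩ := hpath (ε / 3) (by positivity)
  have hμ : 0 < min (min (ε / 3) (r / 2)) ((1 / 2) ^ k / 4) := by positivity
  -- Only elements of Γ are admissible entries, so the path is moved slightly into Γ; its start must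
  -- remain exactly 1.
  have happ : ∀ i, ∃ a ∈ Γ, d a (p i) < min (min (ε / 3) (r / 2)) ((1 / 2) ^ k / 4) ∧
      (∀ m ≤ k, a ∈ V m ∧
        dK m (S m a) 1 < min (min (ε / 3) (r / 2)) ((1 / 2) ^ k / 4)) ∧ (i = 0 → a = 1) := by
    intro i
    by_cases hi : i = 0
    · refine ⟨1, Γ.one_mem, ?_, fun m _ => ⟨(V m).one_mem, ?_⟩, fun _ => rfl⟩
      · rwa [hi, hp0, hd.self]
      · rwa [hS1, (hdK m).self]
    · obtain ⟨a, ha, h1, h2⟩ := exists_approx hdK hd hΓ hV hS (fun m => (hL _ (hpL i) m).1) k hμ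
      refine ⟨a, ha, h1, fun m hm => ⟨(h2 m hm).1, ?_⟩, fun h => absurd h hi⟩
      have := (h2 m hm).2
      rwa [(hL _ (hpL i) m).2] at this
  choose a haΓ had haV ha0 using happ
  have ha00 : a 0 = 1 := ha0 0 rfl
  have hstep : ∀ i, d (a i) (a (i + 1)) < ε := by
    intro i
    have t1 := (had i).trans_le ((min_le_left _ _).trans (min_le_left _ _))
    have t2 := (had (i + 1)).trans_le ((min_le_left _ _).trans (min_le_left _ _))
    have t3 := hp i
    have t4 := hd.triangle (a i) (p i) (a (i + 1))
    have t5 := hd.triangle (p i) (p (i + 1)) (a (i + 1))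
    rw [hd.comm (p (i + 1)) (a (i + 1))] at t5
    linarith
  let C : Set G := a '' Set.Iic q
  have hC : C.Finite := (Set.finite_Iic q).image a
  have hC1 : (1 : G) ∈ C := ⟨0, Nat.zero_le _, ha00⟩
  have hCΓ : ∀ b ∈ C, b ∈ Γ := by
    rintro _ ⟨i, -, rfl⟩
    exact haΓ i
  have hj : ∀ m ∈ Set.Iic k, ∃ j₀, ∀ K ≥ j₀, ∀ x : ℕ → G,
        (∀ i ≤ K, x i = 1) → (∀ i, x i ∈ C) → (∀ i, d (x i) (x (i + 1)) < ρ m) → C ⊆ F K →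
        (∀ a ∈ C, dK m (coordHom H m (stepValue Φ N K a)) (coordHom H m 1) ≤ (1 / 2) ^ k / 4) →
          ∀ n, dK m (coordHom H m (ratio Φ x 1 n)) (coordHom H m 1) ≤ 4 * ((1 / 2) ^ k / 4) := by
    intro m hm
    refine hρC m C hC hC1 ?_
    rintro _ ⟨i, -, rfl⟩ _ ⟨i', -, rfl⟩
    exact hneg m _ (haΓ i) _ (haΓ i') ((V m).mul_mem (haV i m hm).1 ((V m).inv_mem (haV i' m hm).1))
  have hev1 := (eventually_all_finite (Set.finite_Iic k)).2 fun m hm =>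
    eventually_atTop.2 (hj m hm)
  have hev2 : ∀ᶠ K in atTop, ∀ b ∈ C, b ∈ F K := by
    refine (eventually_all_finite hC).2 fun b hb => ?_
    obtain ⟨i, hi⟩ := hΓF b (hCΓ b hb)
    filter_upwards [eventually_ge_atTop i] with K hK
    exact (c 0).F_mono hK hi
  have hev3 : ∀ᶠ K in atTop, ∀ m ∈ Set.Iic k, ∀ b ∈ C,
      dK m (coordHom H m (stepValue Φ N K b)) 1 < (1 / 2) ^ k / 4 := by
    refine (eventually_all_finite (Set.finite_Iic k)).2 fun m hm =>
      (eventually_all_finite hC).2 ?_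
    rintro _ ⟨i, -, rfl⟩
    have h1 := (haV i m hm).2.trans_le (min_le_right _ _)
    have h2 := (hdK m).tendsto_iff.1 (hlim m _ (haΓ i) (haV i m hm).1) _ (sub_pos.2 h1)
    filter_upwards [h2] with K hK
    have := (hdK m).triangle (coordHom H m (stepValue Φ N K (a i))) (S m (a i)) 1
    linarith
  obtain ⟨K, ⟨⟨hK1, hK2⟩, hK3⟩, hkK⟩ :=
    (((hev1.and hev2).and hev3).and (eventually_ge_atTop k)).exists
  -- A tent with truncated subtraction: 0 up to K + 1, rising to q at K + 1 + q, back to 0 at K + 1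
  -- + 2q and after.
  let τ : ℕ → ℕ := fun i => min (i - (K + 1)) (K + 1 + 2 * q - i)
  have hτq : ∀ i, τ i ≤ q := fun i => by simp only [τ]; omega
  have hx1 : ∀ i ≤ K, a (τ i) = 1 := fun i hi => by
    rw [show τ i = 0 by simp only [τ]; omega, ha00]
  have hxC : ∀ i, a (τ i) ∈ C := fun i => ⟨τ i, hτq i, rfl⟩
  refine ⟨fun i => a (τ i), K + 1 + 2 * q, K + 1 + q, by omega, by omega, by omega, fun i => ?_,
    fun i hi => hx1 i (by omega), fun i hi => ?_, ?_, fun m hm n => ?_⟩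
  · dsimp only
    rcases le_total i K with hi | hi
    · rw [hx1 i hi]
      exact (c 0).F_one i
    · exact (c 0).F_mono hi (hK2 _ (hxC i))
  · dsimp only
    rw [show τ i = 0 by simp only [τ]; omega, ha00]
  · dsimp only
    rw [show τ (K + 1 + q) = q by simp only [τ]; omega]
    have t1 := (had q).trans_le ((min_le_left _ _).trans (min_le_right _ _))
    have t2 := hd.triangle (p q) (a q) 1
    rw [hd.comm (p q) (a q)] at t2
    linarith
  · refine (hK1 m hm (fun i => a (τ i)) hx1 hxC (fun i => ?_) hK2
      (fun b hb => ?_) n).trans_eq (by ring)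
    · refine lt_of_lt_of_le ?_ (hερ m hm)
      have h3 : τ (i + 1) = τ i ∨ τ (i + 1) = τ i + 1 ∨ τ i = τ (i + 1) + 1 := by
        simp only [τ]
        omega
      rcases h3 with h3 | h3 | h3
      · rwa [h3, hd.self]
      · rw [h3]
        exact hstep _
      · rw [h3, hd.comm]
        exact hstep _
    · rw [map_one]
      exact (hK3 m hm b hb).le

/-- A subgroup on which the limit homomorphism is trivial has no paths with arbitrarily small
steps leaving a fixed ball. -/
theorem not_forall_exists_path [∀ m, IsTopologicalGroup (K m)] [∀ m, PolishSpace (K m)]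
    (hdK : ∀ m, IsCompatDist (dK m)) (hd : IsCompatDist d)
    (hH : IsClosed (H : Set (∀ m, K m)))
    (c : ∀ m, Coding (fun a b => dK m (coordHom H m a) (coordHom H m b)) F Φ N m)
    (hrev : ∀ x y : ℕ → G, (∀ i, x i ∈ F i) → (∀ i, y i ∈ F i) →
      (∃ a, Tendsto (ratio Φ x y) atTop (𝓝 a)) →
        ∃ g, Tendsto (fun i => x i * (y i)⁻¹) atTop (𝓝 g))
    (hΓ : Dense (Γ : Set G)) (hΓF : ∀ g ∈ Γ, ∃ i, g ∈ F i)
    (hV : ∀ m, IsOpen (V m : Set G)) (hS : ∀ m, ∀ v ∈ V m, ContinuousAt (S m) v)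
    (hneg : ∀ m, ∀ a ∈ Γ, ∀ b ∈ Γ, a * b⁻¹ ∈ V m →
      Coding.Negligible (fun a b => dK m (coordHom H m a) (coordHom H m b)) F Φ N m {(a, b)})
    (hlim : ∀ m, ∀ a ∈ Γ, a ∈ V m →
      Tendsto (fun j => coordHom H m (stepValue Φ N j a)) atTop (𝓝 (S m a)))
    (hS1 : ∀ m, S m 1 = 1) {L : Subgroup G} (hL : ∀ g ∈ L, ∀ m, g ∈ V m ∧ S m g = 1) {r : ℝ}
    (hr : 0 < r) : ¬ ∀ ε > 0, ∃ (q : ℕ) (p : ℕ → G), p 0 = 1 ∧ r ≤ d (p q) 1 ∧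
      (∀ i, p i ∈ L) ∧ ∀ i, d (p i) (p (i + 1)) < ε := by
  intro hpath
  choose x e t hke hkt hte hxF hxl hxr hxt hxs using fun k : ℕ =>
    exists_excursion hdK hd c hΓ hΓF hV hS hneg hlim hS1 hL hr hpath k
  obtain ⟨s, hs, hs0, hs1, hsK⟩ := exists_blocks e 0 fun k _ => hke k
  have hcauchy := exists_tendsto_of_coord_cauchy hdK H hH
    (ratio Φ (fun t => x (s (blk s t)) t) 1) (fun m ε hε =>
      (c m).cauchy_of_excursions hs hs1 hxF hxl hxr (fun k hk n => hxs k m hk n) hε)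
  obtain ⟨g, hg⟩ := hrev _ _ (fun i => hxF _ i) (fun i => (c 0).F_one i) hcauchy
  simp only [inv_one, mul_one] at hg
  have h1 := hd.tendsto_iff.1 hg (r / 4) (by positivity)
  obtain ⟨n, hn⟩ := eventually_atTop.1 h1
  -- Block n starts with the value 1 at s n and is at distance at least r/2 from 1 at t (s n), so
  -- the convergent sequence would be within r/4 of both.
  have hsn : n ≤ s n := hs.le_apply
  have t1 := hn (s n) hsn
  have t2 := hn (t (s n)) (hsn.trans (hkt _))
  rw [blk_eq hs le_rfl (hs (Nat.lt_succ_self n)), hxl _ _ le_rfl] at t1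
  rw [blk_eq hs (hkt _) (by rw [hs1]; exact Nat.lt_succ_of_le (hte _))] at t2
  have t3 := hxt (s n)
  have t4 := hd.triangle (x (s n) (t (s n))) g 1
  rw [hd.comm g 1] at t4
  linarith

end

/-- A coding of the sequences in a group by sequences in a closed subgroup of a product of
strongly NSS groups determines a homomorphism with non-archimedean kernel. -/
theorem exists_hom_of_coding {G : Type*} [Group G] [TopologicalSpace G] [IsTopologicalGroup G]
    {K : ℕ → Type*} [∀ m, Group (K m)] [∀ m, TopologicalSpace (K m)]
    [∀ m, IsTopologicalGroup (K m)] [∀ m, PolishSpace (K m)]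
    (hK' : ∀ m, IsStronglyNSS (K m)) {dK : ∀ m, K m → K m → ℝ} {H : Subgroup (∀ m, K m)}
    {F : ℕ → Set G} {Φ : (ℕ → G) → ℕ → H} {N : ℕ → ℕ} {d : G → G → ℝ} {Γ : Subgroup G}
    (hdK : ∀ m, IsCompatDist (dK m)) (hd : IsCompatDist d)
    (hH : IsClosed (H : Set (∀ m, K m)))
    (c : ∀ m, Coding (fun a b => dK m (coordHom H m a) (coordHom H m b)) F Φ N m)
    (hrev : ∀ x y : ℕ → G, (∀ i, x i ∈ F i) → (∀ i, y i ∈ F i) →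
      (∃ a, Tendsto (ratio Φ x y) atTop (𝓝 a)) →
        ∃ g, Tendsto (fun i => x i * (y i)⁻¹) atTop (𝓝 g))
    (hΓ : Dense (Γ : Set G)) (hΓF : ∀ g ∈ Γ, ∃ i, g ∈ F i) :
    ∃ W : Subgroup G,
      (∃ V : ℕ → Subgroup G, (∀ n, IsClopen (V n : Set G)) ∧ W = ⨅ n, V n) ∧
      Subgroup.connectedComponentOfOne G ≤ W ∧
      ∃ S : W →* H, Continuous S ∧ NonarchimedeanGroup S.ker := by
  choose V S hV hneg hSmul hScont hlim using fun m =>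
    (c m).exists_hom (hdK m) (hK' m) (coordHom H m) hd hΓ hΓF
  have hclopen : ∀ m, IsClopen (V m : Set G) := fun m =>
    ⟨(V m).isClosed_of_isOpen (hV m), hV m⟩
  have hS1 : ∀ m, S m 1 = 1 := fun m => by
    have := hSmul m 1 (V m).one_mem 1 (V m).one_mem
    rw [one_mul] at this
    exact (left_eq_mul.1 this)
  have hW : ∀ w : (⨅ m, V m : Subgroup G), ∀ m, (w : G) ∈ V m := fun w m =>
    (Subgroup.mem_iInf.1 w.2) m
  let T : (⨅ m, V m : Subgroup G) →* H :=
    { toFun := fun w => ⟨fun m => S m w, limit_mem hdK hd hH hΓ hV hScont hlim (hW w)⟩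
      map_one' := by
        ext m
        exact hS1 m
      map_mul' := fun u v => by
        ext m
        exact hSmul m u (hW u m) v (hW v m) }
  have hTc : Continuous T := by
    refine Continuous.subtype_mk (continuous_pi fun m => ?_) _
    rw [continuous_iff_continuousAt]
    intro w
    exact ContinuousAt.comp (hScont m w (hW w m)) continuous_subtype_val.continuousAt
  refine ⟨⨅ m, V m, ⟨V, hclopen, rfl⟩, le_iInf fun m => ?_, T, hTc, ?_⟩
  · exact (hclopen m).connectedComponent_subset (V m).one_mem
  · let L : Subgroup G := T.ker.map (⨅ m, V m : Subgroup G).subtype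
    have hL : ∀ g ∈ L, ∀ m, g ∈ V m ∧ S m g = 1 := by
      rintro _ ⟨w, hw, rfl⟩ m
      refine ⟨hW w m, ?_⟩
      have h1 : T w = 1 := hw
      exact congrFun (congrArg Subtype.val h1) m
    refine ⟨fun U hU => ?_⟩
    by_contra hno
    push Not at hno
    let j : T.ker → G := fun k => ((k : (⨅ m, V m : Subgroup G)) : G)
    have hU' : U ∈ comap j (𝓝 (1 : G)) := by
      rw [nhds_subtype_eq_comap, nhds_subtype_eq_comap, comap_comap] at hU
      exact hU
    obtain ⟨O, hO, hOU⟩ := mem_comap.1 hU'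
    obtain ⟨r, hr, hrO⟩ := (hd.mem_nhds _ _).1 hO
    have hj : Continuous j := continuous_subtype_val.comp continuous_subtype_val
    refine not_forall_exists_path hdK hd hH c hrev hΓ hΓF hV hScont hneg hlim hS1 hL hr
      fun ε hε => ?_
    let B : Set T.ker := {k | d (j k) 1 < ε}
    have hB : B ∈ 𝓝 (1 : T.ker) := hj.tendsto' 1 1 rfl (hd.ball_mem 1 hε)
    -- The subgroup generated by an ε-ball of the kernel is open, hence not contained in U; an
    -- element outside U is reached by ε-steps.
    have hopen : IsOpen (Subgroup.closure B : Set T.ker) :=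
      Subgroup.isOpen_of_mem_nhds _ (g := 1) (Filter.mem_of_superset hB Subgroup.subset_closure)
    obtain ⟨k, hk, hkU⟩ := Set.not_subset.1 (hno ⟨Subgroup.closure B, hopen⟩)
    have hkr : r ≤ d (j k) 1 := by
      by_contra hlt
      exact hkU (hOU (hrO _ (not_le.1 hlt)))
    let J : T.ker →* G := (⨅ m, V m : Subgroup G).subtype.comp T.ker.subtype
    have hkL : j k ∈ Subgroup.closure {g | g ∈ L ∧ d g 1 < ε} := by
      have h1 : j k ∈ (Subgroup.closure B).map J := ⟨k, hk, rfl⟩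
      rw [MonoidHom.map_closure] at h1
      refine Subgroup.closure_mono ?_ h1
      rintro _ ⟨b, hb, rfl⟩
      exact ⟨⟨b, b.2, rfl⟩, hb⟩
    obtain ⟨q, p, hp0, hpq, hpL, hp⟩ := Subgroup.exists_path_of_mem_closure hd.toIsInvDist hε hkL
    exact ⟨q, p, hp0, hpq ▸ hkr, hpL, hp⟩

/-! ### From a Borel reduction to a coding -/

/-- A Borel map to a second countable space is continuous on a dense `Gδ` set. -/
theorem exists_continuousOn_of_measurable {X Y : Type*} [TopologicalSpace X] [BaireSpace X]
    [TopologicalSpace Y] [SecondCountableTopology Y] {f : X → Y}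
    (hf : @Measurable X Y (borel X) (borel Y) f) :
    ∃ C : Set X, IsGδ C ∧ Dense C ∧ ContinuousOn f C := by
  let _ : MeasurableSpace X := borel X
  let _ : MeasurableSpace Y := borel Y
  have : BorelSpace X := ⟨rfl⟩
  have : BorelSpace Y := ⟨rfl⟩
  let B := TopologicalSpace.countableBasis Y
  have hB := TopologicalSpace.isBasis_countableBasis Y
  have h1 : ∀ b ∈ B, ∃ u : Set X, IsOpen u ∧ f ⁻¹' b =ᶠ[residual X] u := fun b hb =>
    (hf (hB.isOpen hb).measurableSet).residualEq_isOpen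
  choose! u hu hfu using h1
  have h2 : ∀ᶠ x in residual X, ∀ b ∈ B, (f ⁻¹' b) x = (u b) x :=
    (eventually_countable_ball (TopologicalSpace.countable_countableBasis Y)).2 hfu
  obtain ⟨C, hC, hCG, hCd⟩ := mem_residual.1 h2
  refine ⟨C, hCG, hCd, fun x hx => ?_⟩
  rw [ContinuousWithinAt, hB.nhds_hasBasis.tendsto_right_iff]
  rintro b ⟨hb, hxb⟩
  have hxu : x ∈ u b := (hC hx b hb).to_iff.mp hxb
  filter_upwards [mem_nhdsWithin_of_mem_nhds ((hu b hb).mem_nhds hxu), self_mem_nhdsWithin]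
    with y hyu hyC
  exact (hC hyC b hb).to_iff.mpr hyu

/-- A basic neighbourhood in the product restricts only finitely many entries. -/
theorem exists_forall_eq_of_mem_nhds {G : Type*} [TopologicalSpace G] {u : ℕ → G}
    {O : Set (ℕ → G)} (hO : O ∈ 𝓝 u) :
    ∀ᶠ L in atTop, ∀ u' : ℕ → G, (∀ i < L, u' i = u i) → u' ∈ O := by
  rw [nhds_pi, Filter.mem_pi] at hO
  obtain ⟨I, hI, t, ht, hIt⟩ := hO
  obtain ⟨M, hM⟩ := hI.bddAbove
  filter_upwards [eventually_gt_atTop M] with L hL u' hu'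
  refine hIt fun i hi => ?_
  rw [hu' i ((hM hi).trans_lt hL)]
  exact mem_of_mem_nhds (ht i)

/-- The sequences with entries in `A` that are constant from `l` on. -/
def constFrom {G : Type*} (A : Set G) (l : ℕ) : Set (ℕ → G) :=
  {p | (∀ i, p i ∈ A) ∧ ∀ i ≥ l, p i = p l}

theorem finite_constFrom {G : Type*} {A : Set G} (hA : A.Finite) (l : ℕ) :
    (constFrom A l).Finite := by
  refine ((Set.Finite.pi' (ι := Fin (l + 1)) (t := fun _ => A) fun _ => hA).image
    fun f (i : ℕ) => f ⟨min i l, by omega⟩).subset ?_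
  rintro p ⟨hp, hpl⟩
  refine ⟨fun i => p i, fun i => hp i, funext fun i => ?_⟩
  rcases le_total i l with h | h
  · simp [min_eq_left h]
  · simp [min_eq_right h, hpl i h]

section

variable {G H : Type*} [Group G] [TopologicalSpace G] [Group H]
  [TopologicalSpace H]

theorem exists_osc_le {δ : H → H → ℝ} (hδ : IsInvDist δ)
    (hδc : Continuous fun p : H × H => δ p.1 p.2) {u : ℕ → H} {a : H}
    (hu : Tendsto u atTop (𝓝 a)) {ε : ℝ} (hε : 0 < ε) :
    ∃ N, ∀ n ≥ N, ∀ n' ≥ N, δ (u n) (u n') < ε := by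
  have h1 : Tendsto (fun n => δ (u n) a) atTop (𝓝 0) := by
    have h2 : Tendsto (fun n => (u n, a)) atTop (𝓝 (a, a)) := hu.prodMk_nhds tendsto_const_nhds
    have h3 := (hδc.tendsto (a, a)).comp h2
    simpa [hδ.self, Function.comp_def] using h3
  obtain ⟨N, hN⟩ := eventually_atTop.1 (h1.eventually_lt_const (half_pos hε))
  refine ⟨N, fun n hn n' hn' => ?_⟩
  have t1 := hN n hn
  have t2 := hN n' hn'
  have t3 := hδ.triangle (u n) a (u n')
  rw [hδ.comm a] at t3
  linarith

/-- The effect of a fixed multiplier settles at a time which is locally constant at generic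
points. -/
theorem residual_settled [IsTopologicalGroup G] [IsTopologicalGroup H] [BaireSpace (ℕ → G)]
    {δ : H → H → ℝ}
    (hδc : Continuous fun p : H × H => δ p.1 p.2) {θ : (ℕ → G) → ℕ → H} {C : Set (ℕ → G)}
    (hC : IsGδ C) (hCd : Dense C) (hθ : ContinuousOn θ C) (r : ℕ → G) {ε : ℝ}
    (hr : ∀ u, ∃ N, ∀ n ≥ N, ∀ n' ≥ N, δ (ratio θ (r * u) u n) (ratio θ (r * u) u n') ≤ ε) :
    ∀ᶠ u in residual (ℕ → G), ∃ N, ∀ᶠ u' in 𝓝 u, u' ∈ C → r * u' ∈ C → ∀ n ≥ N, ∀ n' ≥ N,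
      δ (ratio θ (r * u') u' n) (ratio θ (r * u') u' n') ≤ ε := by
  let s : Set (ℕ → G) := C ∩ (r * ·) ⁻¹' C
  let A : ℕ → Set (ℕ → G) := fun N =>
    {u | ∀ n ≥ N, ∀ n' ≥ N, δ (ratio θ (r * u) u n) (ratio θ (r * u) u n') ≤ ε}
  have hsG : IsGδ ((r * ·) ⁻¹' C) := hC.preimage (continuous_const_mul r)
  have hsd : Dense ((r * ·) ⁻¹' C) := hCd.preimage (isOpenMap_mul_left r)
  have hs : IsGδ s := hC.inter hsG
  -- Baire on the dense Gδ set: the settled sets cover it, so the interiors of their closures have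
  -- dense union. Continuity of θ on C passes the estimate to limit points in s.
  have hd := hs.dense_iUnion_interior_of_closed (hCd.inter_of_Gδ hC hsG hsd)
    (f := fun N => closure (A N ∩ s)) (fun N => isClosed_closure) (fun u hu => by
      obtain ⟨N, hN⟩ := hr u
      exact Set.mem_iUnion.2 ⟨N, subset_closure ⟨hN, hu⟩⟩)
  filter_upwards [residual_of_dense_open (isOpen_iUnion fun N => isOpen_interior) hd] with u hu
  obtain ⟨N, hN⟩ := Set.mem_iUnion.1 hu
  refine ⟨N, ?_⟩
  filter_upwards [isOpen_interior.mem_nhds hN] with v hv hvC hrvC n hn n' hn'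
  have hvcl : v ∈ closure (A N ∩ s) := interior_subset hv
  rw [mem_closure_iff_nhdsWithin_neBot] at hvcl
  have h1 : Tendsto θ (𝓝[A N ∩ s] v) (𝓝 (θ v)) :=
    (hθ v hvC).mono_left (nhdsWithin_mono v fun w hw => hw.2.1)
  have h2 : Tendsto (fun w => θ (r * w)) (𝓝[A N ∩ s] v) (𝓝 (θ (r * v))) := by
    have h0 : Tendsto θ (𝓝[C] (r * v)) (𝓝 (θ (r * v))) := hθ _ hrvC
    refine h0.comp (tendsto_nhdsWithin_iff.2 ⟨?_, ?_⟩)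
    · exact ((continuous_const_mul r).tendsto v).mono_left nhdsWithin_le_nhds
    · filter_upwards [self_mem_nhdsWithin] with w hw
      exact hw.2.2
  have h3 : ∀ n, Tendsto (fun w => ratio θ (r * w) w n) (𝓝[A N ∩ s] v)
      (𝓝 (ratio θ (r * v) v n)) := fun n =>
    (tendsto_pi_nhds.1 h2 n).mul (tendsto_pi_nhds.1 h1 n).inv
  have h4 := (hδc.tendsto _).comp ((h3 n).prodMk_nhds (h3 n'))
  refine le_of_tendsto h4 ?_
  filter_upwards [self_mem_nhdsWithin] with w hw
  exact hw.1 n hn n' hn'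

/-- A point all of whose translates by eventually constant sequences are generic. -/
theorem exists_generic [IsTopologicalGroup G] [IsTopologicalGroup H] [BaireSpace (ℕ → G)]
    {δ : ℕ → H → H → ℝ}
    (hδ : ∀ m, IsInvDist (δ m)) (hδc : ∀ m, Continuous fun p : H × H => δ m p.1 p.2)
    {θ : (ℕ → G) → ℕ → H} {C : Set (ℕ → G)} (hC : IsGδ C) (hCd : Dense C) (hθ : ContinuousOn θ C)
    (hred : ∀ x y : ℕ → G, (∃ g, Tendsto (fun i => x i * (y i)⁻¹) atTop (𝓝 g)) →
      ∃ a, Tendsto (ratio θ x y) atTop (𝓝 a))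
    {F : ℕ → Set G} (hF : ∀ j, (F j).Finite) :
    ∃ z : ℕ → G, ∀ j l, ∀ p ∈ constFrom (F j) l, p * z ∈ C ∧ ∀ p' ∈ constFrom (F j) l, ∀ m q : ℕ,
      ∃ N, ∀ᶠ u in 𝓝 (p * z), u ∈ C → p' * p⁻¹ * u ∈ C → ∀ n ≥ N, ∀ n' ≥ N,
        δ m (ratio θ (p' * p⁻¹ * u) u n) (ratio θ (p' * p⁻¹ * u) u n') ≤ (1 / 2) ^ q := by
  have hres : ∀ᶠ z in residual (ℕ → G), ∀ j l, ∀ p ∈ constFrom (F j) l, p * z ∈ C ∧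
      ∀ p' ∈ constFrom (F j) l, ∀ m q : ℕ,
        ∃ N, ∀ᶠ u in 𝓝 (p * z), u ∈ C → p' * p⁻¹ * u ∈ C → ∀ n ≥ N, ∀ n' ≥ N,
          δ m (ratio θ (p' * p⁻¹ * u) u n) (ratio θ (p' * p⁻¹ * u) u n') ≤ (1 / 2) ^ q := by
    rw [eventually_countable_forall]
    intro j
    rw [eventually_countable_forall]
    intro l
    have hfin := finite_constFrom (hF j) l
    rw [eventually_all_finite hfin]
    intro p hp
    have ht : Tendsto (p * ·) (residual (ℕ → G)) (residual (ℕ → G)) :=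
      tendsto_residual_of_isOpenMap (continuous_const_mul p) (isOpenMap_mul_left p)
    refine (ht.eventually (residual_of_dense_Gδ hC hCd)).and ?_
    rw [eventually_all_finite hfin]
    intro p' hp'
    rw [eventually_countable_forall]
    intro m
    rw [eventually_countable_forall]
    intro q
    refine ht.eventually (residual_settled (hδc m) hC hCd hθ (p' * p⁻¹) fun u => ?_)
    -- The multiplier p' * p⁻¹ is constant from l on, so the two points are equivalent and their
    -- θ-quotient converges.
    obtain ⟨a, ha⟩ := hred (p' * p⁻¹ * u) u ⟨p' l * (p l)⁻¹, by
      refine tendsto_const_nhds.congr' ?_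
      filter_upwards [eventually_ge_atTop l] with i hi
      simp [hp.2 i hi, hp'.2 i hi]⟩
    obtain ⟨N, hN⟩ := exists_osc_le (hδ m) (hδc m) ha (show (0 : ℝ) < (1 / 2) ^ q by positivity)
    exact ⟨N, fun n hn n' hn' => (hN n hn n' hn').le⟩
  exact (dense_of_mem_residual hres).nonempty

/-- One block of the construction of a coding: if `u` agrees with `p * z` before `L`, where `p`
is constant from `l` on, then the effect of changing `p` has settled at time `N`, and `θ u` is
determined up to a small error before time `N`. -/
def BlockProp (δ : ℕ → H → H → ℝ) (θ : (ℕ → G) → ℕ → H) (O : ℕ → Set (ℕ → G)) (F : ℕ → Set G)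
    (z : ℕ → G) (j l N L : ℕ) : Prop :=
  ∀ p ∈ constFrom (F j) l, ∀ u : ℕ → G, (∀ i < L, u i = (p * z) i) →
    (∀ i ≤ j, u ∈ O i) ∧
    (u ∈ ⋂ i, O i → (∀ p' ∈ constFrom (F j) l, ∀ m ≤ j, p' * p⁻¹ * u ∈ ⋂ i, O i →
      ∀ n ≥ N, ∀ n' ≥ N,
        δ m (ratio θ (p' * p⁻¹ * u) u n) (ratio θ (p' * p⁻¹ * u) u n') ≤ (1 / 2) ^ j) ∧
      ∀ n ≤ N, ∀ m ≤ j, δ m (θ (p * z) n) (θ u n) ≤ (1 / 2) ^ (j + 1))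

/-- Finiteness of `constFrom (F j) l` gives one settling time N for all pairs. Only then is L
chosen, so that agreement before L puts u in the neighbourhoods attached to N and determines θ up to
N. The error is 2⁻⁽ʲ⁺¹⁾ because two sequences will be compared through one model p * z. -/
theorem exists_blockProp {δ : ℕ → H → H → ℝ}
    (hδ : ∀ m, IsInvDist (δ m)) (hδc : ∀ m, Continuous fun p : H × H => δ m p.1 p.2)
    {θ : (ℕ → G) → ℕ → H} {O : ℕ → Set (ℕ → G)} (hO : ∀ i, IsOpen (O i))
    (hθ : ContinuousOn θ (⋂ i, O i)) {F : ℕ → Set G} (hF : ∀ j, (F j).Finite) {z : ℕ → G}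
    (hz : ∀ j l, ∀ p ∈ constFrom (F j) l, p * z ∈ ⋂ i, O i ∧ ∀ p' ∈ constFrom (F j) l, ∀ m q : ℕ,
      ∃ N, ∀ᶠ u in 𝓝 (p * z), u ∈ ⋂ i, O i → p' * p⁻¹ * u ∈ ⋂ i, O i → ∀ n ≥ N, ∀ n' ≥ N,
        δ m (ratio θ (p' * p⁻¹ * u) u n) (ratio θ (p' * p⁻¹ * u) u n') ≤ (1 / 2) ^ q)
    (j l N₀ : ℕ) : ∃ N > N₀, ∃ L > l, BlockProp δ θ O F z j l N L := by
  have hfin := finite_constFrom (hF j) l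
  have h1 : ∀ᶠ N in atTop, ∀ p ∈ constFrom (F j) l, ∀ p' ∈ constFrom (F j) l, ∀ m ∈ Set.Iic j,
      ∀ᶠ u in 𝓝 (p * z), u ∈ ⋂ i, O i → p' * p⁻¹ * u ∈ ⋂ i, O i → ∀ n ≥ N, ∀ n' ≥ N,
        δ m (ratio θ (p' * p⁻¹ * u) u n) (ratio θ (p' * p⁻¹ * u) u n') ≤ (1 / 2) ^ j := by
    rw [eventually_all_finite hfin]
    intro p hp
    rw [eventually_all_finite hfin]
    intro p' hp'
    rw [eventually_all_finite (Set.finite_Iic j)]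
    intro m hm
    obtain ⟨N, hN⟩ := (hz j l p hp).2 p' hp' m j
    filter_upwards [eventually_ge_atTop N] with M hM
    filter_upwards [hN] with u hu h1 h2 n hn n' hn'
    exact hu h1 h2 n (hM.trans hn) n' (hM.trans hn')
  obtain ⟨N, hN, hN₀⟩ := (h1.and (eventually_gt_atTop N₀)).exists
  refine ⟨N, hN₀, ?_⟩
  have h2 : ∀ᶠ L in atTop, ∀ p ∈ constFrom (F j) l, ∀ u : ℕ → G, (∀ i < L, u i = (p * z) i) →
      ((∀ i ∈ Set.Iic j, u ∈ O i) ∧ ∀ p' ∈ constFrom (F j) l, ∀ m ∈ Set.Iic j,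
        (u ∈ ⋂ i, O i → p' * p⁻¹ * u ∈ ⋂ i, O i → ∀ n ≥ N, ∀ n' ≥ N,
        δ m (ratio θ (p' * p⁻¹ * u) u n) (ratio θ (p' * p⁻¹ * u) u n') ≤ (1 / 2) ^ j)) ∧
      ∀ n ∈ Set.Iic N, ∀ m ∈ Set.Iic j, (u ∈ ⋂ i, O i →
        δ m (θ (p * z) n) (θ u n) ≤ (1 / 2) ^ (j + 1)) := by
    rw [eventually_all_finite hfin]
    intro p hp
    refine exists_forall_eq_of_mem_nhds (u := p * z) (O := {u | _}) ?_
    have hpz := (hz j l p hp).1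
    refine Filter.Eventually.and (Filter.Eventually.and ?_ ?_) ?_
    · rw [eventually_all_finite (Set.finite_Iic j)]
      exact fun i _ => (hO i).mem_nhds (Set.mem_iInter.1 hpz i)
    · rw [eventually_all_finite hfin]
      intro p' hp'
      rw [eventually_all_finite (Set.finite_Iic j)]
      exact fun m hm => hN p hp p' hp' m hm
    · rw [eventually_all_finite (Set.finite_Iic N)]
      intro n _
      rw [eventually_all_finite (Set.finite_Iic j)]
      intro m _
      have t1 := tendsto_pi_nhds.1 (hθ (p * z) hpz) n
      have t2 := ((hδc m).tendsto _).comp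
        ((tendsto_const_nhds (x := θ (p * z) n)).prodMk_nhds t1)
      simp only [(hδ m).self] at t2
      have t3 := t2.eventually_lt_const (show (0 : ℝ) < (1 / 2) ^ (j + 1) by positivity)
      rw [eventually_nhdsWithin_iff] at t3
      filter_upwards [t3] with u hu huO
      exact (hu huO).le
  obtain ⟨L, hL, hLl⟩ := (h2.and (eventually_gt_atTop l)).exists
  refine ⟨L, hLl, fun p hp u hu => ?_⟩
  obtain ⟨⟨a1, a2⟩, a3⟩ := hL p hp u hu
  exact ⟨a1, fun huO => ⟨fun p' hp' m hm h => a2 p' hp' m hm huO h,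
    fun n hn m hm => a3 n hn m hm huO⟩⟩

/-- A Borel reduction yields a coding. -/
theorem exists_coding [IsTopologicalGroup G] [IsTopologicalGroup H] [PolishSpace G]
    [PolishSpace H] {δ : ℕ → H → H → ℝ}
    (hδ : ∀ m, IsInvDist (δ m)) (hδc : ∀ m, Continuous fun p : H × H => δ m p.1 p.2)
    (hred : BorelReducible (inducedEquiv G) (inducedEquiv H)) {F : ℕ → Set G}
    (hF : ∀ j, (F j).Finite) (hFm : Monotone F) (hF1 : ∀ j, 1 ∈ F j) :
    ∃ (Φ : (ℕ → G) → ℕ → H) (N : ℕ → ℕ), (∀ m, Coding (δ m) F Φ N m) ∧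
      ∀ x y : ℕ → G, (∀ i, x i ∈ F i) → (∀ i, y i ∈ F i) →
        (∃ a, Tendsto (ratio Φ x y) atTop (𝓝 a)) →
          ∃ g, Tendsto (fun i => x i * (y i)⁻¹) atTop (𝓝 g) := by
  obtain ⟨θ, hθm, hθ⟩ := hred
  let _ := TopologicalSpace.upgradeIsCompletelyMetrizable (ℕ → G)
  have hθ' : ∀ x y : ℕ → G, (∃ g, Tendsto (fun i => x i * (y i)⁻¹) atTop (𝓝 g)) ↔
      ∃ a, Tendsto (ratio θ x y) atTop (𝓝 a) := hθ
  obtain ⟨C, hCG, hCd, hCθ⟩ := exists_continuousOn_of_measurable hθm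
  obtain ⟨z, hz⟩ := exists_generic hδ hδc hCG hCd hCθ (fun x y => (hθ' x y).1) hF
  obtain ⟨O, hO, rfl⟩ := isGδ_iff_eq_iInter_nat.1 hCG
  choose Nf hNf Lf hLf hB using exists_blockProp hδ hδc hO hCθ hF hz
  -- The state before stage j holds the start of block j and the previous settling time, whence the
  -- shift by one in `N`.
  let st : ℕ → ℕ × ℕ := fun j => Nat.rec (0, 0)
    (fun j q => (Lf j q.1 q.2, Nf j q.1 q.2)) j
  let l : ℕ → ℕ := fun j => (st j).1
  let N : ℕ → ℕ := fun j => (st (j + 1)).2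
  have hl : StrictMono l := strictMono_nat_of_lt_succ fun j => hLf j _ _
  have hN : StrictMono N := strictMono_nat_of_lt_succ fun j => hNf (j + 1) _ _
  have hblock : ∀ j, BlockProp δ θ O F z j (l j) (N j) (l (j + 1)) := fun j => hB j _ _
  let E : (ℕ → G) → ℕ → G := fun x t => x (blk l t)
  -- `E x` repeats x i over block i; `w x k` freezes it at entry k and so lies in the finite set of
  -- stage k, while agreeing with `E x` before block k + 1.
  let w : (ℕ → G) → ℕ → ℕ → G := fun x k t => x (min (blk l t) k)
  have hw : ∀ x : ℕ → G, (∀ i, x i ∈ F i) → ∀ k, w x k ∈ constFrom (F k) (l k) := by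
    intro x hx k
    refine ⟨fun t => hFm (min_le_right _ _) (hx _), fun t ht => ?_⟩
    have h1 : k ≤ blk l t := le_blk hl ht
    have h2 : k ≤ blk l (l k) := le_blk hl le_rfl
    simp only [w, min_eq_right h1, min_eq_right h2]
  have hagree : ∀ x : ℕ → G, ∀ k, ∀ t < l (k + 1), (E x * z) t = (w x k * z) t := by
    intro x k t ht
    have h1 : blk l t ≤ k := Nat.lt_succ_iff.1 (blk_lt hl k.succ_pos ht)
    simp only [E, w, Pi.mul_apply, min_eq_left h1]
  have hEC : ∀ x : ℕ → G, (∀ i, x i ∈ F i) → E x * z ∈ ⋂ i, O i := fun x hx =>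
    Set.mem_iInter.2 fun i => (hblock i _ (hw x hx i) _ (hagree x i)).1 i le_rfl
  have hEl : ∀ (x : ℕ → G) j, E x (l j) = x j := fun x j => by
    simp only [E, blk_eq hl le_rfl (hl (Nat.lt_succ_self j))]
  have hblk : Tendsto (blk l) atTop atTop :=
    tendsto_atTop.2 fun k => (eventually_ge_atTop (l k)).mono fun t ht => le_blk hl ht
  have hquot : ∀ x y : ℕ → G, ∀ t, (E x * z) t * ((E y * z) t)⁻¹ =
      x (blk l t) * (y (blk l t))⁻¹ := by
    intro x y t
    simp only [E, Pi.mul_apply]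
    group
  refine ⟨fun x => θ (E x * z), N, fun m => ⟨hδ m, hFm, hF1, hN, ?_, ?_, ?_⟩, ?_⟩
  · intro k hk x y hx hy hxy n hn n' hn'
    have h1 := ((hblock k _ (hw y hy k) _ (hagree y k)).2 (hEC y hy)).1 _ (hw x hx k) m hk
    -- Since x i * (y i)⁻¹ is constant from k on, the frozen quotient is the full multiplier.
    have h2 : w x k * (w y k)⁻¹ * (E y * z) = E x * z := by
      funext t
      simp only [w, E, Pi.mul_apply, Pi.inv_apply]
      rcases le_total (blk l t) k with h | h
      · rw [min_eq_left h]
        group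
      · rw [min_eq_right h, ← hxy _ h]
        group
    rw [h2] at h1
    exact h1 (hEC x hx) n hn n' hn'
  · intro k hk x y hx hy hxy n hn
    have h1 := ((hblock k _ (hw x hx k) _ (hagree x k)).2 (hEC x hx)).2 n hn m hk
    have h2 := ((hblock k _ (hw y hy k) _ (hagree y k)).2 (hEC y hy)).2 n hn m hk
    have h3 : w x k = w y k := funext fun t => hxy _ (min_le_right _ _)
    rw [h3] at h1
    have h4 := (hδ m).triangle (θ (E x * z) n) (θ (w y k * z) n) (θ (E y * z) n)
    rw [(hδ m).comm (θ (E x * z) n) (θ (w y k * z) n)] at h4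
    rw [pow_succ] at h1 h2
    linarith
  · intro x y hx hy hxy η hη
    obtain ⟨a, ha⟩ := (hθ' (E x * z) (E y * z)).1 ⟨1, by
      simp_rw [hquot]
      exact hxy.comp hblk⟩
    obtain ⟨n₀, hn₀⟩ := exists_osc_le (hδ m) (hδc m) ha hη
    exact ⟨n₀, fun n hn => hn₀ n hn n₀ le_rfl⟩
  · intro x y hx hy hxy
    obtain ⟨g, hg⟩ := (hθ' (E x * z) (E y * z)).2 hxy
    refine ⟨g, ?_⟩
    have h1 := hg.comp hl.tendsto_atTop
    simp_rw [Function.comp_def, hquot] at h1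
    refine h1.congr fun j => ?_
    rw [blk_eq hl le_rfl (hl (Nat.lt_succ_self j))]

end

/-! ### The theorem -/

theorem theorem6
    {G : Type*} [Group G] [TopologicalSpace G] [IsTopologicalGroup G] [PolishSpace G]
    (hG : IsTSI G)
    {K : ℕ → Type*} [∀ m, Group (K m)] [∀ m, TopologicalSpace (K m)]
    [∀ m, IsTopologicalGroup (K m)] [∀ m, PolishSpace (K m)]
    (hK : ∀ m, IsTSI (K m)) (hK' : ∀ m, IsStronglyNSS (K m))
    (H : Subgroup (∀ m, K m)) (hH : IsClosed (H : Set (∀ m, K m))) :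
    (BorelReducible (inducedEquiv G) (inducedEquiv H) →
      ∃ W : Subgroup G,
        (∃ V : ℕ → Subgroup G, (∀ n, IsClopen (V n : Set G)) ∧ W = ⨅ n, V n) ∧
        Subgroup.connectedComponentOfOne G ≤ W ∧
        ∃ S : W →* H, Continuous S ∧ NonarchimedeanGroup S.ker) ∧
    (∀ S : G →* H, Continuous S → NonarchimedeanGroup S.ker →
      IsClosed (Set.range S) →
      (∃ f : Set.Icc (0 : ℝ) 1 → H, IsEmbedding f) →
      BorelReducible (inducedEquiv G) (inducedEquiv H)) := by
  refine ⟨fun hred => ?_, fun S hS hker hr ⟨f, hf⟩ =>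
    borelReducible_of_closed_range hG hK H hH S hS hker hr f hf⟩
  have hP : PolishSpace H := hH.isClosedEmbedding_subtypeVal.polishSpace
  obtain ⟨d, hd⟩ := hG.exists_compatDist
  choose dK hdK using fun m => (hK m).exists_compatDist
  obtain ⟨γ, hγ⟩ := TopologicalSpace.exists_dense_seq G
  obtain ⟨e, he⟩ := exists_surjective_nat (FreeGroup ℕ)
  -- An enumeration of the free group on a dense sequence gives increasing finite sets exhausting a
  -- countable dense subgroup.
  let F : ℕ → Set G := fun j => insert 1 ((fun i => FreeGroup.lift γ (e i)) '' Set.Iic j)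
  have hF : ∀ j, (F j).Finite := fun j => ((Set.finite_Iic j).image _).insert 1
  have hFm : Monotone F := fun i j hij =>
    Set.insert_subset_insert (Set.image_mono (Set.Iic_subset_Iic.2 hij))
  have hc : ∀ m, Continuous (coordHom H m) := fun m =>
    (continuous_apply m).comp continuous_subtype_val
  obtain ⟨Φ, N, c, hrev⟩ := exists_coding
    (fun m => (hdK m).toIsInvDist.comp (coordHom H m))
    (fun m => (hdK m).continuous.comp
      (((hc m).comp continuous_fst).prodMk ((hc m).comp continuous_snd)))
    hred hF hFm (fun j => Set.mem_insert 1 _)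
  refine exists_hom_of_coding (Γ := (FreeGroup.lift γ).range) hK' hdK hd hH c hrev ?_ ?_
  · refine hγ.mono ?_
    rintro _ ⟨n, rfl⟩
    exact ⟨FreeGroup.of n, FreeGroup.lift_apply_of⟩
  · rintro _ ⟨w, rfl⟩
    obtain ⟨i, rfl⟩ := he w
    exact ⟨i, Set.mem_insert_of_mem _ ⟨i, Set.mem_Iic.2 le_rfl, rfl⟩⟩
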